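/- Let $M$ be a real $n\times n$ matrix. For $\alpha\subseteq[n]$ let $C_\alpha(M)$ be the matrix whose $j$-th column is $-M_{\bullet j}$ if $j\in\alpha$ and the standard basis vector $e_j$ if $j\notin\alpha$. If $C_\alpha(M)$ is invertible and $q\in\mathbb{R}^n$, let $\mathrm{out}_q(\alpha,M)=\{i\in[n] : (C_\alpha(M)^{-1}q)_i>0\}$. A *violation of the unique sink property* of $M$ is one of the following: (a) a set $\alpha\subseteq[n]$ such that $C_\alpha(M)$ is singular; or (b) a vector $q\in\mathbb{R}^n$ and two distinct sets $\alpha,\beta\subseteq[n]$ such that $C_\alpha(M)$ and $C_\beta(M)$ are invertible, $(\alpha\oplus\beta)\cap(\mathrm{out}_q(\alpha,M)\oplus\mathrm{out}_q(\beta,M))=\varnothing$ (where $\oplus$ is symmetric difference), and $q$ is not totally degenerate for this pair, i.e. for some $i\in\alpha\oplus\beta$ one of $(C_\alpha(M)^{-1}q)_i$, $(C_\beta(M)^{-1}q)_i$ is nonzero (in particular, every $q$ is allowed that is nondegenerate, i.e. for which no coordinate of any $C_\gamma(M)^{-1}q$, $\gamma\subseteq[n]$, vanishes). **Theorem.** There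 is a polynomial-time algorithm which, given $M$ and a violation of the unique sink property of $M$, finds a set $\gamma\subseteq[n]$ with $\det(M_{\gamma\gamma})\le 0$. Precisely: there is a single program (independent of $n$) for a random access machine, whose elementary steps are the arithmetic operations, copying, loading integer constants and sign tests on field elements, and simple operations on and comparisons of index registers, such that (1) for all real $M$ and all violations it outputs such a $\gamma$ after a number of steps bounded by a polynomial in $n$; and (2) when $M$ and $q$ are rational and each operation is charged the bit lengths of the numbers it involves, it outputs such a $\gamma$ with total cost bounded by a polynomial in the bit length of the input. -/

import Mathlib

namespace PMatrixUSO

open scoped symmDiff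

/-! ### Complementary matrices, outmaps, and the two kinds of certificates -/

section Certificates

variable {K : Type*} [Field K] [LinearOrder K] {n : ℕ}

/-- The complementary matrix of `α` induced by `M`: its `j`-th column is `-M_{•j}` if `j ∈ α`, and
the standard basis vector `e_j` otherwise. -/
def compMatrix (α : Finset (Fin n)) (M : Matrix (Fin n) (Fin n) K) : Matrix (Fin n) (Fin n) K :=
  Matrix.of fun i j => if j ∈ α then -M i j else (1 : Matrix (Fin n) (Fin n) K) i j

/-- The coordinates of `q` with respect to the columns of the complementary matrix of `α`
(meaningful when this matrix is invertible). -/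
noncomputable def compCoord (q : Fin n → K) (α : Finset (Fin n)) (M : Matrix (Fin n) (Fin n) K) : Fin n → K :=
  Matrix.mulVec (compMatrix α M)⁻¹ q

/-- The outmap of `q` at the vertex `α`. Boolean vectors are identified with subsets of `Fin n`. -/
noncomputable def outmap (q : Fin n → K) (α : Finset (Fin n)) (M : Matrix (Fin n) (Fin n) K) :
    Finset (Fin n) :=
  Finset.univ.filter fun i => 0 < compCoord q α M i

/-- The data of a claimed failure of the unique sink property: one set, or a vector and two
sets. -/
inductive USOCertificate (K : Type*) (n : ℕ) where
  | singular (α : Finset (Fin n))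
  | pair (q : Fin n → K) (α β : Finset (Fin n))

/-- The certificate is a genuine violation of the unique sink property for `M`: either a singular
complementary matrix, or `q` and two distinct sets `α`, `β` at which the outmap of `q` is defined,
such that `α ∆ β` is disjoint from the symmetric difference of the outmaps. In the second case `q`
must not be totally degenerate there: some coordinate indexed by `α ∆ β` of one of the two
solutions is nonzero. (This is implied by nondegeneracy of `q`. Without it `q = 0` would be a
"violation" for every matrix, as all its outmaps are empty.) -/
def USOCertificate.IsViolation (M : Matrix (Fin n) (Fin n) K) : USOCertificate K n → Prop
  | .singular α => ¬ IsUnit (compMatrix α M)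
  | .pair q α β =>
      α ≠ β ∧ IsUnit (compMatrix α M) ∧ IsUnit (compMatrix β M) ∧
      (α ∆ β) ∩ (outmap q α M ∆ outmap q β M) = ∅ ∧
      ∃ i ∈ α ∆ β, compCoord q α M i ≠ 0 ∨ compCoord q β M i ≠ 0

/-- `γ` is the index set of a nonpositive principal minor of `M`. -/
def IsNonposMinor (M : Matrix (Fin n) (Fin n) K) (γ : Finset (Fin n)) : Prop :=
  (M.submatrix (fun i : {i // i ∈ γ} => (i : Fin n)) (fun i : {i // i ∈ γ} => (i : Fin n))).det ≤ 0

end Certificates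

/-! ### A random access machine over an ordered field

Programs are finite pieces of syntax that do not depend on the input. The memory consists of index
registers, holding natural numbers, and of two-dimensional arrays, holding elements of the field.
Array cells are addressed through index registers. The only operations on index registers are
resetting, copying, and adding or subtracting one, so that after `t` steps an index register exceeds
the largest initial one by at most `t`; the only operations on cells are the four arithmetic
operations, copying, and loading integer constants. Control flow consists of branching and of
bounded loops. -/

/-- The memory. -/
structure Store (K : Type*) where
  /-- contents of the index registers -/
  idx : ℕ → ℕ
  /-- `arr a i j` is the entry `(i, j)` of the array `a` -/
  arr : ℕ → ℕ → ℕ → K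

/-- A reference to the entry of array `name` whose row and column are the current contents of
the index registers `row` and `col`. -/
structure Cell where
  name : ℕ
  row : ℕ
  col : ℕ

/-- The arithmetic operations (division by zero returns zero). -/
inductive ArithOp where
  | add | sub | mul | div

/-- Elementary instructions; the first argument is the destination. -/
inductive Instr where
  | idxZero (r : ℕ)
  | idxCopy (r s : ℕ)
  | idxSucc (r : ℕ)
  | idxPred (r : ℕ)
  | const (x : Cell) (c : ℤ)
  | copy (x y : Cell)
  | arith (o : ArithOp) (x y z : Cell)

/-- Tests: comparison of index registers, and positivity of a cell. -/
inductive Test where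
  | idxLt (r s : ℕ)
  | pos (x : Cell)

/-- Programs. `loop r p` executes `p` as often as the contents of the index register `r` say at
the moment when the loop is entered. -/
inductive Prog where
  | skip
  | instr (c : Instr)
  | seq (p₁ p₂ : Prog)
  | ite (b : Test) (p₁ p₂ : Prog)
  | loop (r : ℕ) (p : Prog)

section Machine

variable {K : Type*} [Field K] [LinearOrder K]

/-- The contents of a cell. -/
def Store.read (σ : Store K) (x : Cell) : K :=
  σ.arr x.name (σ.idx x.row) (σ.idx x.col)

/-- Overwrite a cell. -/
def Store.write (σ : Store K) (x : Cell) (v : K) : Store K where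
  idx := σ.idx
  arr := fun a i j =>
    if a = x.name ∧ i = σ.idx x.row ∧ j = σ.idx x.col then v else σ.arr a i j

/-- Overwrite an index register. -/
def Store.setIdx (σ : Store K) (r v : ℕ) : Store K where
  idx := Function.update σ.idx r v
  arr := σ.arr

def ArithOp.eval : ArithOp → K → K → K
  | .add, a, b => a + b
  | .sub, a, b => a - b
  | .mul, a, b => a * b
  | .div, a, b => a / b

def Instr.exec : Instr → Store K → Store K
  | .idxZero r, σ => σ.setIdx r 0
  | .idxCopy r s, σ => σ.setIdx r (σ.idx s)
  | .idxSucc r, σ => σ.setIdx r (σ.idx r + 1)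
  | .idxPred r, σ => σ.setIdx r (σ.idx r - 1)
  | .const x c, σ => σ.write x (c : K)
  | .copy x y, σ => σ.write x (σ.read y)
  | .arith o x y z, σ => σ.write x (o.eval (σ.read y) (σ.read z))

def Test.eval : Test → Store K → Bool
  | .idxLt r s, σ => decide (σ.idx r < σ.idx s)
  | .pos x, σ => decide (0 < σ.read x)

/-- The memory after the execution of a program. -/
def Prog.exec : Prog → Store K → Store K
  | .skip, σ => σ
  | .instr c, σ => c.exec σ
  | .seq p₁ p₂, σ => p₂.exec (p₁.exec σ)
  | .ite b p₁ p₂, σ => if b.eval σ then p₁.exec σ else p₂.exec σ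
  | .loop r p, σ => p.exec^[σ.idx r] σ

/-- The cost of an instruction, where `size` says what it costs to handle a field element in
addition to the basic cost `1`: it is charged for every operand and for the result. -/
def Instr.cost (size : K → ℕ) : Instr → Store K → ℕ
  | .const _ c, _ => 1 + size (c : K)
  | .copy _ y, σ => 1 + size (σ.read y)
  | .arith o _ y z, σ =>
      1 + size (σ.read y) + size (σ.read z) + size (o.eval (σ.read y) (σ.read z))
  | _, _ => 1

def Test.cost (size : K → ℕ) : Test → Store K → ℕ
  | .idxLt _ _, _ => 1
  | .pos x, σ => 1 + size (σ.read x)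

/-- The running time of a program, started on the memory `σ`. -/
def Prog.cost (size : K → ℕ) : Prog → Store K → ℕ
  | .skip, _ => 1
  | .instr c, σ => c.cost size σ
  | .seq p₁ p₂, σ => p₁.cost size σ + p₂.cost size (p₁.exec σ)
  | .ite b p₁ p₂, σ => b.cost size σ + if b.eval σ then p₁.cost size σ else p₂.cost size σ
  | .loop r p, σ => 1 + ∑ k ∈ Finset.range (σ.idx r), (1 + p.cost size (p.exec^[k] σ))

/-- Unit cost: every instruction and every test is one step. -/
def unitSize : K → ℕ := fun _ => 0

/-- The number of bits needed to write down a rational number (sign, numerator, denominator). -/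
def bitSize (x : ℚ) : ℕ := 1 + Nat.size x.num.natAbs + Nat.size x.den

end Machine

/-! ### Input and output -/

section InputOutput

variable {K : Type*} [Field K] [LinearOrder K] {n : ℕ}

/-- A vector as the column `0` of an array, padded by zeros. -/
def vecArray (v : Fin n → K) : ℕ → ℕ → K :=
  fun i j => if h : i < n ∧ j = 0 then v ⟨i, h.1⟩ else 0

/-- The characteristic vector of a set as the column `0` of an array. -/
def setArray (K : Type*) [Field K] (α : Finset (Fin n)) : ℕ → ℕ → K :=
  vecArray fun i => if i ∈ α then 1 else 0

/-- A square matrix as an array, padded by zeros. -/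
def matArray (M : Matrix (Fin n) (Fin n) K) : ℕ → ℕ → K :=
  fun i j => if h : i < n ∧ j < n then M ⟨i, h.1⟩ ⟨j, h.2⟩ else 0

/-- The initial memory. Index register `0` holds `n`, index register `1` the kind of the
certificate (`0` for a singular complementary matrix, `1` for a pair); array `0` holds `M`,
array `1` the set `α`, and, for a pair, array `2` holds `β` and array `3` holds `q`. Everything
else is zero. -/
def inputStore (M : Matrix (Fin n) (Fin n) K) : USOCertificate K n → Store K
  | .singular α =>
      { idx := fun r => if r = 0 then n else 0
        arr := fun a =>
          if a = 0 then matArray M else if a = 1 then setArray K α else fun _ _ => 0 }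
  | .pair q α β =>
      { idx := fun r => if r = 0 then n else if r = 1 then 1 else 0
        arr := fun a =>
          if a = 0 then matArray M else if a = 1 then setArray K α
          else if a = 2 then setArray K β else if a = 3 then vecArray q else fun _ _ => 0 }

/-- The set that is output: the elements `i` for which entry `(i, 0)` of array `4` is nonzero. -/
def outputSet (n : ℕ) (σ : Store K) : Finset (Fin n) :=
  Finset.univ.filter fun i => σ.arr 4 i 0 ≠ 0

/-- The bit length of an input with rational entries (each of the sets takes `n` bits). -/
def inputBits (M : Matrix (Fin n) (Fin n) ℚ) : USOCertificate ℚ n → ℕ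
  | .singular _ => (∑ i, ∑ j, bitSize (M i j)) + n
  | .pair q _ _ => (∑ i, ∑ j, bitSize (M i j)) + (∑ i, bitSize (q i)) + 2 * n

end InputOutput

end PMatrixUSO

/-! A singular `C_α(M)` is immediate: its determinant is, up to sign, the principal minor of `α`, so
that minor is zero.

For a pair, put `x = C_α⁻¹ q` and `y = C_β⁻¹ q`. Let `z` be `x` restricted to `α` minus `y`
restricted to `β`, and `w` the same with the complements of `α` and `β`. Subtracting `C_α x = q =
C_β y` gives `M z = w`. On `α ∆ β` the outmaps agree, so `x i` and `y i` are both positive or both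
nonpositive, whence `z i * w i ≤ 0`; elsewhere this product is zero. The nondegeneracy clause gives
`z ≠ 0` (`signReversal_of_pair`). So `M` reverses the sign of `z`. With `u = |z|` and `v = |w|` the
matrix `M diag(u) + diag(v)` then kills a nonzero sign vector times scaling, hence is singular
(`det_mixMatrix_eq_zero`).

This determinant is `∑ γ, (∏ γ, u) (∏ γᶜ, v) det M_γγ` with nonnegative weights, so some minor is
nonpositive. It is found by the method of conditional expectations. The determinant is linear in
each pair `(u i, v i)`, so as long as it is nonpositive and the pair is nonnegative and nonzero,
replacing the pair by `(1, 0)` or by `(0, 1)` keeps it nonpositive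
(`det_mixMatrix_zero_one_nonpos`). One determinant decides which, and after `n` rounds the matrix
has determinant exactly `det M_γγ`.

Determinants are computed without division, up to the factor `n!`, by a rescaled Faddeev–LeVerrier
recursion (`leVerrier_card`), and the two solutions by Cramer's rule with denominators cleared; only
signs and common factors matter, so these factors are harmless.

The step count is polynomial because every loop runs `n` times. For the bit cost, all entries are
fractions over powers of one common denominator, and a static typing of the program shows that the
exponent of each array grows at most linearly in the number of steps (`Prog.cost_bitSize_le`). The
program is a fixed sequence of typed phases, so the composed bound stays polynomial. -/

namespace PMatrixUSO

open scoped symmDiff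

/-! ### Division-free determinants: the Faddeev–LeVerrier recursion -/

section FaddeevLeVerrier

open Polynomial Matrix

variable {R : Type*} [CommRing R] {m : Type*} [Fintype m] [DecidableEq m]

/-- Jacobi's formula for matrices of polynomials. -/
theorem derivative_det (C : Matrix m m R[X]) :
    derivative C.det = (C.adjugate * C.map derivative).trace := by
  -- By Cramer's rule a diagonal entry of the product is the determinant with one column
  -- differentiated; the trace is then the Leibniz rule column by column.
  have h : ∀ i, (C.adjugate * C.map derivative) i i =
      (C.updateCol i fun j => derivative (C j i)).det := fun i => by
    rw [← cramer_apply, cramer_eq_adjugate_mulVec]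
    rfl
  simp only [trace, diag_apply, h, det_apply]
  rw [Finset.sum_comm, derivative_sum]
  refine Finset.sum_congr rfl fun σ _ => ?_
  rw [← Finset.smul_sum, Units.smul_def, Units.smul_def, derivative_smul, derivative_prod_finset]
  congr 1
  refine Finset.sum_congr rfl fun i _ => ?_
  rw [← Finset.prod_erase_mul _ _ (Finset.mem_univ i)]
  simp only [updateCol_self]
  congr 1
  refine Finset.prod_congr rfl fun j hj => ?_
  rw [updateCol_ne (Finset.ne_of_mem_erase hj)]

/-- The matrices and traces of the Faddeev–LeVerrier recursion, rescaled by factorials so that no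
division occurs. -/
def leVerrier (A : Matrix m m R) : ℕ → Matrix m m R × R
  | 0 => (1, 1)
  | k + 1 =>
      ((A * (leVerrier A k).1).trace • (1 : Matrix m m R) -
          ((k + 1 : ℕ) : R) • (A * (leVerrier A k).1),
        (A * (leVerrier A k).1).trace)

/-- The matrix polynomial `1 + X A`. -/
noncomputable def onePencil (A : Matrix m m R) : Matrix m m R[X] :=
  (X : R[X]) • A.map C + (1 : Matrix m m R).map C

omit [Fintype m] in
theorem onePencil_apply (A : Matrix m m R) (i j : m) :
    onePencil A i j = X * C (A i j) + C ((1 : Matrix m m R) i j) := by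
  by_cases h : i = j <;> simp [onePencil, one_apply, h]

theorem coeff_onePencil_mul (A : Matrix m m R) (Q : Matrix m m R[X]) (k : ℕ) (i j : m) :
    ((onePencil A * Q) i j).coeff (k + 1) =
      ∑ l, A i l * (Q l j).coeff k + (Q i j).coeff (k + 1) := by
  rw [mul_apply, finsetSum_coeff]
  simp only [onePencil_apply, add_mul, coeff_add, mul_assoc, coeff_X_mul, coeff_C_mul,
    Finset.sum_add_distrib]
  congr 1
  have : ∀ l, (C ((1 : Matrix m m R) i l) * Q l j).coeff (k + 1) =
      if i = l then (Q l j).coeff (k + 1) else 0 := fun l => by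
    by_cases h : i = l <;> simp [h, one_apply]
  simp only [← coeff_C_mul, this]
  simp

/-- Two identities for the pencil `P = 1 + X A` drive the induction. Coefficient `k + 1` of `P * adj
P = det P` expresses the next adjugate coefficient by the previous one. Jacobi's formula, as `P' =
A`, expresses `k + 1` times the next coefficient of `det P` as a trace. The factorial absorbs the
factor `k + 1`, which would otherwise have to be divided out. -/
theorem leVerrier_eq (A : Matrix m m R) (k : ℕ) :
    (leVerrier A k).1 = (k.factorial : R) • Matrix.of (fun i j => ((onePencil A).adjugate i j).coeff k) ∧
      (leVerrier A k).2 = (k.factorial : R) * (onePencil A).det.coeff k := by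
  have hmul : onePencil A * (onePencil A).adjugate = (onePencil A).det • 1 := mul_adjugate _
  have h0 : (onePencil A).det.coeff 0 = 1 := by
    rw [onePencil, coeff_det_X_add_C_zero, det_one]
  induction k with
  | zero =>
    refine ⟨?_, by simp [leVerrier, h0]⟩
    ext i j
    have := congrArg (fun p => p.coeff 0) (congrFun (congrFun hmul i) j)
    simp only [mul_apply, finsetSum_coeff, onePencil_apply, mul_coeff_zero, coeff_add,
      coeff_X_zero, coeff_C_zero, zero_mul, zero_add] at this
    have hl : ∑ l, (1 : Matrix m m R) i l * ((onePencil A).adjugate l j).coeff 0 =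
        ((onePencil A).adjugate i j).coeff 0 := by simp [one_apply]
    rw [hl] at this
    simp only [leVerrier, Nat.factorial_zero, Nat.cast_one, one_smul, of_apply, this]
    by_cases hij : i = j <;> simp [hij, h0, one_apply]
  | succ k ih =>
    set N : Matrix m m R := Matrix.of (fun i j => ((onePencil A).adjugate i j).coeff k) with hN
    -- Coefficient `k` of Jacobi's formula.
    have htr : (A * N).trace = ((k + 1 : ℕ) : R) * (onePencil A).det.coeff (k + 1) := by
      have h := congrArg (fun p => p.coeff k) (derivative_det (onePencil A))
      simp only [coeff_derivative] at h
      rw [Nat.cast_add, Nat.cast_one, mul_comm, h, trace_mul_comm]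
      simp only [trace, diag_apply, mul_apply, map_apply, finsetSum_coeff]
      refine Finset.sum_congr rfl fun i _ => Finset.sum_congr rfl fun j _ => ?_
      simp [onePencil_apply, hN]
    have hfac : (((k + 1).factorial : ℕ) : R) = (k.factorial : R) * ((k + 1 : ℕ) : R) := by
      rw [Nat.factorial_succ, Nat.cast_mul, mul_comm]
    have hE : (A * (leVerrier A k).1).trace =
        ((k + 1).factorial : R) * (onePencil A).det.coeff (k + 1) := by
      rw [ih.1, Matrix.mul_smul, trace_smul, htr, hfac, smul_eq_mul, mul_assoc]
    refine ⟨?_, hE⟩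
    rw [leVerrier, hE, ih.1]
    ext i j
    have h := congrArg (fun p => p.coeff (k + 1)) (congrFun (congrFun hmul i) j)
    simp only [coeff_onePencil_mul] at h
    have h' : ((onePencil A).adjugate i j).coeff (k + 1) =
        (onePencil A).det.coeff (k + 1) * (1 : Matrix m m R) i j - (A * N) i j := by
      rw [eq_sub_iff_add_eq, mul_apply, add_comm]
      simp only [hN, of_apply]
      rw [h]
      by_cases hij : i = j <;> simp [hij, one_apply]
    simp only [Matrix.sub_apply, Matrix.smul_apply, Matrix.mul_smul, smul_eq_mul, of_apply, h', hfac]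
    ring

/-- The Faddeev–LeVerrier recursion computes the determinant. -/
theorem leVerrier_card (A : Matrix m m R) :
    (leVerrier A (Fintype.card m)).2 = ((Fintype.card m).factorial : R) * A.det := by
  rw [(leVerrier_eq A _).2, onePencil, coeff_det_X_add_C_card]

end FaddeevLeVerrier

/-! ### Mixtures of the columns of `M` with unit vectors, and principal minors -/

section Minors

variable {K : Type*} [Field K] {n : ℕ}

/-- The matrix whose `j`-th column is `u j • M_{•j} + v j • e_j`. -/
def mixMatrix (M : Matrix (Fin n) (Fin n) K) (u v : Fin n → K) : Matrix (Fin n) (Fin n) K :=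
  Matrix.of fun i j => u j * M i j + if i = j then v j else 0

/-- Columns outside `γ` are multiples of unit vectors, so the matrix is block triangular with a
diagonal block on the complement and a column-scaled principal submatrix on `γ`. -/
theorem det_mixMatrix_indicator (M : Matrix (Fin n) (Fin n) K) (γ : Finset (Fin n))
    (u v : Fin n → K) (hu : ∀ j ∉ γ, u j = 0) (hv : ∀ j ∈ γ, v j = 0) :
    (mixMatrix M u v).det = (∏ j ∈ γ, u j) * (∏ j ∈ γᶜ, v j) *
      (M.submatrix (fun i : {i // i ∈ γ} => (i : Fin n)) fun i : {i // i ∈ γ} => (i : Fin n)).det := by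
  rw [Matrix.twoBlockTriangular_det' _ (fun i => i ∈ γ)]
  · have h1 : Matrix.toSquareBlockProp (mixMatrix M u v) (fun i => i ∈ γ) =
        Matrix.of fun i j : {i // i ∈ γ} => u j *
          M.submatrix (fun i : {i // i ∈ γ} => (i : Fin n)) (fun i : {i // i ∈ γ} => (i : Fin n)) i j := by
      ext i j
      simp [mixMatrix, Matrix.toSquareBlockProp, hv j j.2]
    have h2 : Matrix.toSquareBlockProp (mixMatrix M u v) (fun i => i ∉ γ) =
        Matrix.diagonal fun j : {i // i ∉ γ} => v j := by
      ext i j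
      simp [mixMatrix, Matrix.toSquareBlockProp, hu j j.2, Matrix.diagonal_apply, Subtype.ext_iff]
      split_ifs with h
      · rw [h]
      · rfl
    have h3 : ∏ j : {i // i ∈ γ}, u j = ∏ j ∈ γ, u j :=
      (Finset.prod_subtype γ (fun _ => Iff.rfl) u).symm
    have h4 : ∏ j : {i // i ∉ γ}, v j = ∏ j ∈ γᶜ, v j :=
      (Finset.prod_subtype γᶜ (fun _ => Finset.mem_compl) v).symm
    rw [h1, h2, Matrix.det_diagonal, h4, mul_right_comm]
    congr 1
    rw [← h3]
    have h5 := Matrix.det_mul_row (fun j : {i // i ∈ γ} => u j)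
      (M.submatrix (fun i : {i // i ∈ γ} => (i : Fin n)) fun i : {i // i ∈ γ} => (i : Fin n))
    rw [← h5]
    congr!
  · intro i hi j hj
    have : i ≠ j := fun h => hj (h ▸ hi)
    simp [mixMatrix, hu j hj, this]

theorem compMatrix_eq_mixMatrix (M : Matrix (Fin n) (Fin n) K) (α : Finset (Fin n)) :
    compMatrix α M = mixMatrix M (fun j => if j ∈ α then -1 else 0) fun j => if j ∈ α then 0 else 1 := by
  ext i j
  by_cases h : j ∈ α <;> simp [compMatrix, mixMatrix, h, Matrix.one_apply]

/-- Linearity of the determinant in column `i`, the only column that depends on `u i` and `v i`. -/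
theorem det_mixMatrix_split (M : Matrix (Fin n) (Fin n) K) (u v : Fin n → K) (i : Fin n) :
    (mixMatrix M u v).det =
      u i * (mixMatrix M (Function.update u i 1) (Function.update v i 0)).det +
      v i * (mixMatrix M (Function.update u i 0) (Function.update v i 1)).det := by
  have hA : mixMatrix M (Function.update u i 1) (Function.update v i 0) =
      (mixMatrix M u v).updateCol i fun k => M k i := by
    ext k j
    by_cases h : j = i
    · subst h; simp [mixMatrix]
    · simp [mixMatrix, h]
  have hB : mixMatrix M (Function.update u i 0) (Function.update v i 1) =
      (mixMatrix M u v).updateCol i fun k => if k = i then 1 else 0 := by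
    ext k j
    by_cases h : j = i
    · subst h; simp [mixMatrix]
    · simp [mixMatrix, h]
  rw [hA, hB, ← Matrix.det_updateCol_smul, ← Matrix.det_updateCol_smul, ← Matrix.det_updateCol_add]
  congr 1
  ext k j
  by_cases h : j = i
  · subst h; simp [mixMatrix]
  · simp [h]

variable [LinearOrder K]

theorem isNonposMinor_of_singular (M : Matrix (Fin n) (Fin n) K) (α : Finset (Fin n))
    (h : ¬ IsUnit (compMatrix α M)) : IsNonposMinor M α := by
  rw [Matrix.isUnit_iff_isUnit_det, isUnit_iff_ne_zero, not_not, compMatrix_eq_mixMatrix,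
    det_mixMatrix_indicator M α _ _ (fun j hj => by simp [hj]) (fun j hj => by simp [hj])] at h
  rw [IsNonposMinor]
  refine le_of_eq ?_
  rcases mul_eq_zero.1 h with h | h
  · refine absurd h (mul_ne_zero (Finset.prod_ne_zero_iff.2 ?_) (Finset.prod_ne_zero_iff.2 ?_))
    · intro a ha; simp [ha]
    · intro a ha; simp [Finset.mem_compl.1 ha]
  · exact h

variable [IsStrictOrderedRing K]

/-- The rounding step: a nonnegative, nontrivial combination of two positive determinants would be
positive. -/
theorem det_mixMatrix_zero_one_nonpos (M : Matrix (Fin n) (Fin n) K) (u v : Fin n → K) (i : Fin n)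
    (hu : 0 ≤ u i) (hv : 0 ≤ v i) (huv : u i ≠ 0 ∨ v i ≠ 0) (hdet : (mixMatrix M u v).det ≤ 0)
    (hpos : 0 < (mixMatrix M (Function.update u i 1) (Function.update v i 0)).det) :
    (mixMatrix M (Function.update u i 0) (Function.update v i 1)).det ≤ 0 := by
  rw [det_mixMatrix_split M u v i] at hdet
  by_contra! hneg
  rcases huv with h | h
  · have := mul_pos (lt_of_le_of_ne hu h.symm) hpos
    have := mul_nonneg hv hneg.le
    linarith
  · have := mul_pos (lt_of_le_of_ne hv h.symm) hneg
    have := mul_nonneg hu hpos.le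
    linarith

/-- A vector whose sign is reversed by `M` yields a singular matrix with nonnegative coefficients. -/
theorem det_mixMatrix_eq_zero (M : Matrix (Fin n) (Fin n) K) (z w u v : Fin n → K)
    (hw : M.mulVec z = w) (hzw : ∀ i, z i * w i ≤ 0) (hz : z ≠ 0)
    (hu : ∀ i, z i ≠ 0 ∨ w i ≠ 0 → u i = |z i|) (hv : ∀ i, z i ≠ 0 ∨ w i ≠ 0 → v i = |w i|) :
    (mixMatrix M u v).det = 0 := by
  have hs : ∀ i, ∃ s : K, s * u i = z i ∧ s * v i = - w i := by
    intro i
    by_cases h : z i ≠ 0 ∨ w i ≠ 0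
    · rw [hu i h, hv i h]
      have := hzw i
      rcases lt_trichotomy (z i) 0 with hz' | hz' | hz'
      · have : 0 ≤ w i := by
          by_contra! hh
          exact absurd this (not_le.2 (mul_pos_of_neg_of_neg hz' hh))
        exact ⟨-1, by rw [abs_of_neg hz']; ring, by rw [abs_of_nonneg this]; ring⟩
      · rcases le_total (w i) 0 with hw' | hw'
        · exact ⟨1, by rw [hz']; simp, by rw [abs_of_nonpos hw']; ring⟩
        · exact ⟨-1, by rw [hz']; simp, by rw [abs_of_nonneg hw']; ring⟩
      · have : w i ≤ 0 := by
          by_contra! hh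
          exact absurd this (not_le.2 (mul_pos hz' hh))
        exact ⟨1, by rw [abs_of_pos hz']; ring, by rw [abs_of_nonpos this]; ring⟩
    · push Not at h
      -- Where `z` and `w` both vanish, `s i = 0` works for arbitrary `u i` and `v i`. This freedom
      -- later allows the forbidden pair `(0, 0)` to be replaced by `(0, 1)`.
      exact ⟨0, by simp [h.1], by simp [h.2]⟩
  choose s hs1 hs2 using hs
  rw [← Matrix.exists_mulVec_eq_zero_iff]
  refine ⟨s, ?_, ?_⟩
  · rintro rfl
    exact hz (funext fun i => by simpa using (hs1 i).symm)
  · ext i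
    have : M.mulVec z i = w i := by rw [hw]
    simp only [Matrix.mulVec, dotProduct] at this ⊢
    have h1 : ∀ j, mixMatrix M u v i j * s j = M i j * z j + if i = j then - w j else 0 := by
      intro j
      rw [← hs1 j, ← hs2 j]
      simp only [mixMatrix, Matrix.of_apply]
      split_ifs <;> ring
    simp only [h1, Finset.sum_add_distrib, this]
    simp

end Minors

/-! ### From a violation to a vector whose sign `M` reverses -/

section Violation

variable {K : Type*} [Field K] {n : ℕ}

theorem compMatrix_mulVec_compCoord {M : Matrix (Fin n) (Fin n) K} {q : Fin n → K}
    {α : Finset (Fin n)} (h : IsUnit (compMatrix α M)) :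
    (compMatrix α M).mulVec (compCoord q α M) = q := by
  rw [compCoord, Matrix.mulVec_mulVec, Matrix.mul_nonsing_inv _ ((Matrix.isUnit_iff_isUnit_det _).1 h),
    Matrix.one_mulVec]

/-- The matrix with columns `M_{•j}` for `j ∈ α` and `e_j` for `j ∉ α`. -/
def basisMatrix (α : Finset (Fin n)) (M : Matrix (Fin n) (Fin n) K) : Matrix (Fin n) (Fin n) K :=
  mixMatrix M (fun j => if j ∈ α then 1 else 0) fun j => if j ∈ α then 0 else 1

theorem compMatrix_mulVec (M : Matrix (Fin n) (Fin n) K) (α : Finset (Fin n)) (x : Fin n → K) :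
    (compMatrix α M).mulVec x =
      (fun i => if i ∈ α then 0 else x i) - M.mulVec fun i => if i ∈ α then x i else 0 := by
  ext i
  simp only [Matrix.mulVec, dotProduct, Pi.sub_apply]
  have : ∀ j, compMatrix α M i j * x j =
      (if i = j then if j ∈ α then 0 else x j else 0) - M i j * if j ∈ α then x j else 0 := by
    intro j
    by_cases h : j ∈ α <;> by_cases h' : i = j <;> simp [compMatrix, h, h', Matrix.one_apply]
  simp only [this, Finset.sum_sub_distrib]
  simp

theorem basisMatrix_mulVec (M : Matrix (Fin n) (Fin n) K) (α : Finset (Fin n)) (x : Fin n → K) :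
    (basisMatrix α M).mulVec (fun i => if i ∈ α then -x i else x i) = (compMatrix α M).mulVec x := by
  ext i
  simp only [Matrix.mulVec, dotProduct]
  refine Finset.sum_congr rfl fun j _ => ?_
  by_cases h : j ∈ α <;> simp [compMatrix, basisMatrix, mixMatrix, h, Matrix.one_apply]

/-- Both determinants are the principal minor of `α` times a product of units. -/
theorem basisMatrix_det_ne_zero {M : Matrix (Fin n) (Fin n) K} {α : Finset (Fin n)}
    (h : IsUnit (compMatrix α M)) : (basisMatrix α M).det ≠ 0 := by
  rw [Matrix.isUnit_iff_isUnit_det, isUnit_iff_ne_zero, compMatrix_eq_mixMatrix,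
    det_mixMatrix_indicator M α _ _ (fun j hj => by simp [hj]) (fun j hj => by simp [hj])] at h
  rw [basisMatrix, det_mixMatrix_indicator M α _ _ (fun j hj => by simp [hj])
    (fun j hj => by simp [hj])]
  refine mul_ne_zero (mul_ne_zero ?_ ?_) (right_ne_zero_of_mul h)
  · rw [Finset.prod_ne_zero_iff]; intro a ha; simp [ha]
  · rw [Finset.prod_ne_zero_iff]; intro a ha; simp [Finset.mem_compl.1 ha]

theorem cramer_basisMatrix {M : Matrix (Fin n) (Fin n) K} {α : Finset (Fin n)} (q : Fin n → K)
    (h : IsUnit (compMatrix α M)) (i : Fin n) :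
    (basisMatrix α M).cramer q i =
      (basisMatrix α M).det * (if i ∈ α then -compCoord q α M i else compCoord q α M i) := by
  have hq : (basisMatrix α M).mulVec
      (fun i => if i ∈ α then -compCoord q α M i else compCoord q α M i) = q := by
    rw [basisMatrix_mulVec, compMatrix_mulVec_compCoord h]
  conv_lhs => rw [← hq]
  rw [Matrix.cramer_eq_adjugate_mulVec, Matrix.mulVec_mulVec, Matrix.adjugate_mul,
    Matrix.smul_mulVec, Matrix.one_mulVec]
  rfl

variable [LinearOrder K] [IsStrictOrderedRing K]

/-- The vectors `z` and `w = M z` extracted from a violation with two sets. -/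
theorem signReversal_of_pair {M : Matrix (Fin n) (Fin n) K} {q : Fin n → K} {α β : Finset (Fin n)}
    (h : (USOCertificate.pair q α β).IsViolation M) {a b : K} (ha : a ≠ 0) (hb : b ≠ 0)
    {z w : Fin n → K}
    (hz : ∀ i, z i = a * b * ((if i ∈ α then compCoord q α M i else 0) -
      if i ∈ β then compCoord q β M i else 0))
    (hw : ∀ i, w i = a * b * ((if i ∈ α then 0 else compCoord q α M i) -
      if i ∈ β then 0 else compCoord q β M i)) :
    M.mulVec z = w ∧ (∀ i, z i * w i ≤ 0) ∧ z ≠ 0 := by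
  obtain ⟨-, hα, hβ, hd, i₀, hi₀, hne⟩ := h
  set x := compCoord q α M with hx
  set y := compCoord q β M with hy
  have e1 := compMatrix_mulVec M α x
  have e2 := compMatrix_mulVec M β y
  rw [hx, compMatrix_mulVec_compCoord hα] at e1
  rw [hy, compMatrix_mulVec_compCoord hβ] at e2
  rw [← hx] at e1
  rw [← hy] at e2
  have hab : a * b ≠ 0 := mul_ne_zero ha hb
  have hMz : M.mulVec z = w := by
    have hz' : z = (a * b) • ((fun i => if i ∈ α then x i else 0) - fun i => if i ∈ β then y i else 0) :=
      funext fun i => by rw [hz i]; rfl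
    have hw' : w = (a * b) • ((fun i => if i ∈ α then 0 else x i) - fun i => if i ∈ β then 0 else y i) :=
      funext fun i => by rw [hw i]; rfl
    rw [hz', hw', Matrix.mulVec_smul, Matrix.mulVec_sub]
    congr 1
    rw [sub_eq_sub_iff_add_eq_add]
    have e3 := e1.symm.trans e2
    rw [sub_eq_sub_iff_add_eq_add] at e3
    rw [add_comm, ← e3, add_comm]
  refine ⟨hMz, fun i => ?_, ?_⟩
  · have hsign : i ∈ α ∆ β → 0 ≤ x i * y i := by
      intro hi
      have h2 : i ∉ outmap q α M ∆ outmap q β M := fun h3 => by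
        have : i ∈ (α ∆ β) ∩ (outmap q α M ∆ outmap q β M) := Finset.mem_inter.2 ⟨hi, h3⟩
        rw [hd] at this
        simp at this
      rw [Finset.mem_symmDiff] at h2
      simp only [outmap, Finset.mem_filter, Finset.mem_univ, true_and, ← hx, ← hy] at h2
      push Not at h2
      by_cases hxi : 0 < x i
      · exact (mul_pos hxi (h2.1 hxi)).le
      · have hyi : ¬ 0 < y i := fun h => hxi (h2.2 h)
        exact mul_nonneg_of_nonpos_of_nonpos (not_lt.1 hxi) (not_lt.1 hyi)
    rw [hz i, hw i]
    -- The common factor `a * b` enters `z i * w i` as a square, so its sign is irrelevant.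
    have hsq := mul_self_nonneg (a * b)
    by_cases h1 : i ∈ α <;> by_cases h2 : i ∈ β <;> simp only [h1, h2, if_true, if_false]
    · simp
    · have := mul_nonneg hsq (hsign (by simp [Finset.mem_symmDiff, h1, h2]))
      nlinarith
    · have := mul_nonneg hsq (hsign (by simp [Finset.mem_symmDiff, h1, h2]))
      nlinarith
    · simp
  · rintro hz0
    -- At `i₀ ∈ α ∆ β`, one of `z`, `w` is a multiple of `x i₀` and the other of `y i₀`; both
    -- vanishing contradicts nondegeneracy.
    have hw0 : w = 0 := by rw [← hMz, hz0, Matrix.mulVec_zero]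
    have hz1 := hz i₀
    have hw1 := hw i₀
    rw [hz0, Pi.zero_apply, eq_comm, mul_eq_zero, or_iff_right hab] at hz1
    rw [hw0, Pi.zero_apply, eq_comm, mul_eq_zero, or_iff_right hab] at hw1
    rw [Finset.mem_symmDiff] at hi₀
    rcases hi₀ with ⟨h1, h2⟩ | ⟨h1, h2⟩ <;> simp [h1, h2] at hz1 hw1 <;> simp [hz1, hw1] at hne

end Violation

/-! ### Frame rules and loop invariants for the machine -/

section Frame

def Instr.arrWrites : Instr → List ℕ
  | .const x _ => [x.name]
  | .copy x _ => [x.name]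
  | .arith _ x _ _ => [x.name]
  | _ => []

def Instr.idxWrites : Instr → List ℕ
  | .idxZero r => [r]
  | .idxCopy r _ => [r]
  | .idxSucc r => [r]
  | .idxPred r => [r]
  | _ => []

/-- The arrays that a program may modify. -/
def Prog.arrWrites : Prog → List ℕ
  | .skip => []
  | .instr c => c.arrWrites
  | .seq p₁ p₂ => p₁.arrWrites ++ p₂.arrWrites
  | .ite _ p₁ p₂ => p₁.arrWrites ++ p₂.arrWrites
  | .loop _ p => p.arrWrites

/-- The index registers that a program may modify. -/
def Prog.idxWrites : Prog → List ℕ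
  | .skip => []
  | .instr c => c.idxWrites
  | .seq p₁ p₂ => p₁.idxWrites ++ p₂.idxWrites
  | .ite _ p₁ p₂ => p₁.idxWrites ++ p₂.idxWrites
  | .loop _ p => p.idxWrites

variable {K : Type*} [Field K] [LinearOrder K]

/-- Frame rule. The write sets are computed from the syntax, so for concrete programs the hypothesis
is settled by `decide`. -/
theorem Prog.exec_arr {a : ℕ} (p : Prog) (h : a ∉ p.arrWrites) (σ : Store K) :
    (p.exec σ).arr a = σ.arr a := by
  induction p generalizing σ with
  | skip => rfl
  | instr c =>
    cases c <;> simp [Prog.arrWrites, Instr.arrWrites] at h <;>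
      simp [Prog.exec, Instr.exec, Store.setIdx, Store.write, h]
  | seq p₁ p₂ ih₁ ih₂ =>
    simp only [Prog.arrWrites, List.mem_append, not_or] at h
    rw [Prog.exec, ih₂ h.2, ih₁ h.1]
  | ite b p₁ p₂ ih₁ ih₂ =>
    simp only [Prog.arrWrites, List.mem_append, not_or] at h
    rw [Prog.exec]
    split_ifs
    exacts [ih₁ h.1 σ, ih₂ h.2 σ]
  | loop r p ih =>
    rw [Prog.exec]
    generalize σ.idx r = k
    induction k generalizing σ with
    | zero => rfl
    | succ k ihk => rw [Function.iterate_succ_apply, ihk, ih h]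

theorem Prog.exec_idx {r : ℕ} (p : Prog) (h : r ∉ p.idxWrites) (σ : Store K) :
    (p.exec σ).idx r = σ.idx r := by
  induction p generalizing σ with
  | skip => rfl
  | instr c =>
    cases c <;> simp [Prog.idxWrites, Instr.idxWrites] at h <;>
      simp [Prog.exec, Instr.exec, Store.setIdx, Store.write, h]
  | seq p₁ p₂ ih₁ ih₂ =>
    simp only [Prog.idxWrites, List.mem_append, not_or] at h
    rw [Prog.exec, ih₂ h.2, ih₁ h.1]
  | ite b p₁ p₂ ih₁ ih₂ =>
    simp only [Prog.idxWrites, List.mem_append, not_or] at h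
    rw [Prog.exec]
    split_ifs
    exacts [ih₁ h.1 σ, ih₂ h.2 σ]
  | loop r p ih =>
    rw [Prog.exec]
    generalize σ.idx r = k
    induction k generalizing σ with
    | zero => rfl
    | succ k ihk => rw [Function.iterate_succ_apply, ihk, ih h]

/-- Execute `p` for the values `0, …, n - 1` of the index register `r`, where `n` is the content
of register `0`. -/
def forLoop (r : ℕ) (p : Prog) : Prog :=
  .seq (.instr (.idxZero r)) (.loop 0 (.seq p (.instr (.idxSucc r))))

/-- Invariant rule for counting loops. The invariant speaks of arrays only; the counter, the
untouched registers and the untouched arrays are supplied to `step` by the frame rules. -/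
theorem exec_forLoop {r : ℕ} {p : Prog} (hr : r ≠ 0) (hrp : r ∉ p.idxWrites)
    {σ : Store K} (Inv : ℕ → (ℕ → ℕ → ℕ → K) → Prop) (init : Inv 0 σ.arr)
    (step : ∀ k < σ.idx 0, ∀ τ : Store K, τ.idx r = k →
      (∀ s, s ≠ r → s ∉ p.idxWrites → τ.idx s = σ.idx s) →
      (∀ a, a ∉ p.arrWrites → τ.arr a = σ.arr a) → Inv k τ.arr → Inv (k + 1) (p.exec τ).arr) :
    Inv (σ.idx 0) ((forLoop r p).exec σ).arr := by
  have key : ∀ k ≤ σ.idx 0, ∀ τ : Store K,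
      τ = (Prog.exec (.seq p (.instr (.idxSucc r))))^[k] (σ.setIdx r 0) →
      τ.idx r = k ∧ (∀ s, s ≠ r → s ∉ p.idxWrites → τ.idx s = σ.idx s) ∧
      (∀ a, a ∉ p.arrWrites → τ.arr a = σ.arr a) ∧ Inv k τ.arr := by
    intro k
    induction k with
    | zero =>
      rintro - τ rfl
      exact ⟨by simp [Store.setIdx], fun s hs _ => by simp [Store.setIdx, hs], fun a _ => rfl, init⟩
    | succ k ih =>
      rintro hk τ rfl
      rw [Function.iterate_succ_apply']
      obtain ⟨h1, h2, h3, h4⟩ := ih (by omega) _ rfl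
      set τ := (Prog.exec (.seq p (.instr (.idxSucc r))))^[k] (σ.setIdx r 0)
      refine ⟨?_, fun s hs hsp => ?_, fun a ha => ?_, ?_⟩
      · simp [Prog.exec, Instr.exec, Store.setIdx, Prog.exec_idx p hrp, h1]
      · simp [Prog.exec, Instr.exec, Store.setIdx, Prog.exec_idx p hsp, h2 s hs hsp, hs]
      · simp [Prog.exec, Instr.exec, Store.setIdx, Prog.exec_arr p ha, h3 a ha]
      · exact step k (by omega) τ h1 h2 h3 h4
  have := (key (σ.idx 0) le_rfl _ rfl).2.2.2
  have he : (forLoop r p).exec σ =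
      (Prog.exec (.seq p (.instr (.idxSucc r))))^[σ.idx 0] (σ.setIdx r 0) := by
    simp only [forLoop, Prog.exec, Instr.exec]
    congr 1
    simp [Store.setIdx, Function.update_of_ne hr.symm]
  rw [he]
  exact this

/-- Two nested loops that fill the array `a` entry by entry. -/
theorem exec_forLoop_forLoop {r s a : ℕ} {p : Prog} (hr : r ≠ 0) (hs : s ≠ 0) (hrs : r ≠ s)
    (h0 : 0 ∉ p.idxWrites) (hrp : r ∉ p.idxWrites) (hsp : s ∉ p.idxWrites)
    {σ : Store K} (f : ℕ → ℕ → K)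
    (step : ∀ i < σ.idx 0, ∀ j < σ.idx 0, ∀ τ : Store K, τ.idx r = i → τ.idx s = j →
      (∀ t, t ≠ r → t ≠ s → t ∉ p.idxWrites → τ.idx t = σ.idx t) →
      (∀ b, b ∉ p.arrWrites → τ.arr b = σ.arr b) →
      ∀ i' j', (p.exec τ).arr a i' j' = if i' = i ∧ j' = j then f i j else τ.arr a i' j') :
    ∀ i < σ.idx 0, ∀ j < σ.idx 0, ((forLoop r (forLoop s p)).exec σ).arr a i j = f i j := by
  have h0' : 0 ∉ (forLoop s p).idxWrites := by
    simp [forLoop, Prog.idxWrites, Instr.idxWrites, h0, hs.symm]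
  have hr' : r ∉ (forLoop s p).idxWrites := by
    simp [forLoop, Prog.idxWrites, Instr.idxWrites, hrp, hrs]
  have harr : (forLoop s p).arrWrites = p.arrWrites := by
    simp [forLoop, Prog.arrWrites, Instr.arrWrites]
  refine exec_forLoop hr hr'
    (fun k A => ∀ i < k, ∀ j < σ.idx 0, A a i j = f i j) (by simp) ?_
  intro k hk τ h1 h2 h3 h4
  have hτ0 : τ.idx 0 = σ.idx 0 := h2 0 hr.symm h0'
  have := exec_forLoop (σ := τ) hs hsp
    (fun l A => (∀ i < k, ∀ j < σ.idx 0, A a i j = f i j) ∧ ∀ j < l, A a k j = f k j)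
    ⟨h4, by simp⟩ (by
      intro l hl υ g1 g2 g3 g4
      have := step k hk l (hτ0 ▸ hl) υ ((g2 r hrs hrp).trans h1) g1
        (fun t ht ht' htp => (g2 t ht' htp).trans (h2 t ht (by
          simp [forLoop, Prog.idxWrites, Instr.idxWrites, htp, ht'])))
        (fun b hb => (g3 b hb).trans (h3 b (by rwa [harr])))
      refine ⟨fun i hi j hj => ?_, fun j hj => ?_⟩
      · rw [this, if_neg (by omega), g4.1 i hi j hj]
      · rw [this]
        by_cases hjl : j = l
        · simp [hjl]
        · rw [if_neg (by omega), g4.2 j (by omega)])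
  intro i hi j hj
  rcases Nat.lt_succ_iff_lt_or_eq.1 hi with hi | rfl
  · exact this.1 i hi j hj
  · exact this.2 j (hτ0 ▸ hj)

end Frame

/-! ### Number of steps -/

section UnitCost

variable {K : Type*} [Field K] [LinearOrder K]

/-- All loops of the program run over the index register `0`. -/
def Prog.LoopsOverZero : Prog → Prop
  | .skip => True
  | .instr _ => True
  | .seq p₁ p₂ => p₁.LoopsOverZero ∧ p₂.LoopsOverZero
  | .ite _ p₁ p₂ => p₁.LoopsOverZero ∧ p₂.LoopsOverZero
  | .loop r p => r = 0 ∧ p.LoopsOverZero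

/-- A bound for the number of steps in terms of the number of iterations of each loop. -/
noncomputable def Prog.stepPoly : Prog → Polynomial ℕ
  | .skip => 1
  | .instr _ => 1
  | .seq p₁ p₂ => p₁.stepPoly + p₂.stepPoly
  | .ite _ p₁ p₂ => 1 + p₁.stepPoly + p₂.stepPoly
  | .loop _ p => 1 + Polynomial.X * (1 + p.stepPoly)

theorem Prog.iterate_exec_idx {r : ℕ} (p : Prog) (h : r ∉ p.idxWrites) (k : ℕ) (σ : Store K) :
    (p.exec^[k] σ).idx r = σ.idx r := by
  induction k generalizing σ with
  | zero => rfl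
  | succ k ih => rw [Function.iterate_succ_apply, ih, p.exec_idx h]

/-- Register `0` never changes, so each loop has the same number of iterations whenever it is
entered. -/
theorem Prog.cost_unitSize_le (p : Prog) (hp : p.LoopsOverZero) (h0 : 0 ∉ p.idxWrites) (σ : Store K) :
    p.cost unitSize σ ≤ p.stepPoly.eval (σ.idx 0) := by
  induction p generalizing σ with
  | skip => simp [Prog.cost, Prog.stepPoly]
  | instr c => cases c <;> simp [Prog.cost, Instr.cost, Prog.stepPoly, unitSize]
  | seq p₁ p₂ ih₁ ih₂ =>
    simp only [Prog.idxWrites, List.mem_append, not_or] at h0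
    have h1 := ih₁ hp.1 h0.1 σ
    have h2 := ih₂ hp.2 h0.2 (p₁.exec σ)
    rw [p₁.exec_idx h0.1] at h2
    simp only [Prog.cost, Prog.stepPoly, Polynomial.eval_add]
    omega
  | ite b p₁ p₂ ih₁ ih₂ =>
    simp only [Prog.idxWrites, List.mem_append, not_or] at h0
    have h1 := ih₁ hp.1 h0.1 σ
    have h2 := ih₂ hp.2 h0.2 σ
    have hb : b.cost unitSize σ = 1 := by cases b <;> simp [Test.cost, unitSize]
    simp only [Prog.cost, Prog.stepPoly, Polynomial.eval_add, Polynomial.eval_one, hb]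
    split_ifs <;> omega
  | loop r p ih =>
    obtain ⟨rfl, hp⟩ := hp
    simp only [Prog.cost, Prog.stepPoly, Polynomial.eval_add, Polynomial.eval_mul, Polynomial.eval_X,
      Polynomial.eval_one]
    gcongr
    calc _ ≤ ∑ k ∈ Finset.range (σ.idx 0), (1 + p.stepPoly.eval (σ.idx 0)) := by
            refine Finset.sum_le_sum fun k _ => ?_
            have := ih hp h0 (p.exec^[k] σ)
            rw [p.iterate_exec_idx h0] at this
            omega
      _ = _ := by simp

end UnitCost

/-! ### Heights of rational numbers and bit cost -/

section BitCost

/-- `v` is a fraction with denominator `D ^ h` and a numerator of at most `e * h` bits. -/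
def HasHeight (D e h : ℕ) (v : ℚ) : Prop :=
  ∃ m : ℤ, v * (D : ℚ) ^ h = m ∧ |m| ≤ (2 ^ e) ^ h

variable {D e : ℕ}

theorem HasHeight.mono (hD : D ≤ 2 ^ e) {h h' : ℕ} (hh : h ≤ h') {v : ℚ} (hv : HasHeight D e h v) :
    HasHeight D e h' v := by
  obtain ⟨m, h1, h2⟩ := hv
  obtain ⟨k, rfl⟩ := Nat.exists_eq_add_of_le hh
  refine ⟨m * (D : ℤ) ^ k, by push_cast; rw [← h1, pow_add, mul_assoc], ?_⟩
  rw [abs_mul, abs_pow, Nat.abs_cast, pow_add]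
  have : (D : ℤ) ≤ 2 ^ e := by exact_mod_cast hD
  gcongr

/-- The sum already has denominator `D ^ h`, but its numerator may double. Raising the height by one
multiplies the numerator by `D`, and the hypothesis on `2 * D` covers both factors. -/
theorem HasHeight.add (hD : 2 * D ≤ 2 ^ e) {h : ℕ} {v w : ℚ} (hv : HasHeight D e h v)
    (hw : HasHeight D e h w) : HasHeight D e (h + 1) (v + w) := by
  obtain ⟨m, h1, h2⟩ := hv
  obtain ⟨k, h3, h4⟩ := hw
  refine ⟨(m + k) * D, by push_cast; rw [← h1, ← h3]; ring, ?_⟩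
  rw [abs_mul, Nat.abs_cast, pow_succ]
  have hD' : (2 : ℤ) * D ≤ 2 ^ e := by exact_mod_cast hD
  have h5 := abs_add_le m k
  have h6 : (0 : ℤ) ≤ (2 ^ e) ^ h := by positivity
  calc |m + k| * (D : ℤ) ≤ (2 * (2 ^ e) ^ h) * D := by gcongr; linarith
    _ = (2 ^ e) ^ h * (2 * D) := by ring
    _ ≤ _ := by gcongr

theorem HasHeight.neg {h : ℕ} {v : ℚ} (hv : HasHeight D e h v) : HasHeight D e h (-v) := by
  obtain ⟨m, h1, h2⟩ := hv
  exact ⟨-m, by push_cast; rw [← h1]; ring, by rwa [abs_neg]⟩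

theorem HasHeight.sub (hD : 2 * D ≤ 2 ^ e) {h : ℕ} {v w : ℚ} (hv : HasHeight D e h v)
    (hw : HasHeight D e h w) : HasHeight D e (h + 1) (v - w) :=
  sub_eq_add_neg v w ▸ hv.add hD hw.neg

theorem HasHeight.mul {h k : ℕ} {v w : ℚ} (hv : HasHeight D e h v) (hw : HasHeight D e k w) :
    HasHeight D e (h + k) (v * w) := by
  obtain ⟨m, h1, h2⟩ := hv
  obtain ⟨l, h3, h4⟩ := hw
  refine ⟨m * l, by push_cast; rw [← h1, ← h3]; ring, ?_⟩
  rw [abs_mul, pow_add]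
  gcongr

theorem HasHeight.intCast {c : ℤ} (hc : |c| ≤ 1) : HasHeight D e 0 (c : ℚ) :=
  ⟨c, by simp, by simpa using hc⟩

theorem HasHeight.bitSize_le (hD0 : 0 < D) (hD : D ≤ 2 ^ e) {h : ℕ} {v : ℚ} (hv : HasHeight D e h v) :
    bitSize v ≤ 3 + 2 * (e * h) := by
  obtain ⟨m, h1, h2⟩ := hv
  have h3 : v.num * (D : ℤ) ^ h = m * v.den := by
    have : (v.num : ℚ) = v * v.den := (Rat.mul_den_eq_num v).symm
    have h4 : ((v.num * (D : ℤ) ^ h : ℤ) : ℚ) = ((m * v.den : ℤ) : ℚ) := by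
      push_cast
      rw [this, ← h1]
      ring
    exact_mod_cast h4
  -- In lowest terms the denominator divides `D ^ h`, and the numerator divides `m`; both are
  -- therefore short.
  have hdvd : v.den ∣ D ^ h := by
    have h5 : (v.den : ℤ) ∣ v.num * (D : ℤ) ^ h := ⟨m, by rw [h3, mul_comm]⟩
    have h6 : v.den ∣ v.num.natAbs * D ^ h := by
      have := Int.natAbs_dvd_natAbs.2 h5
      simpa [Int.natAbs_mul, Int.natAbs_pow] using this
    exact Nat.Coprime.dvd_of_dvd_mul_left v.reduced.symm h6
  have hden : v.den ≤ D ^ h := Nat.le_of_dvd (by positivity) hdvd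
  have hDh : D ^ h ≤ (2 ^ e) ^ h := Nat.pow_le_pow_left hD h
  obtain ⟨c, hc⟩ := hdvd
  have hc0 : 0 < c := by
    rcases Nat.eq_zero_or_pos c with rfl | h
    · have : 0 < D ^ h := by positivity
      omega
    · exact h
  have hm : v.num * c = m := by
    have h7 : (v.num * c) * (v.den : ℤ) = m * v.den := by
      rw [← h3]
      have : ((D : ℤ)) ^ h = v.den * c := by exact_mod_cast hc
      rw [this]; ring
    exact mul_right_cancel₀ (by exact_mod_cast v.den_nz) h7
  have hnum : v.num.natAbs ≤ (2 ^ e) ^ h := by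
    have h8 : m.natAbs ≤ (2 ^ e) ^ h := by
      have : ((m.natAbs : ℕ) : ℤ) ≤ (((2 ^ e) ^ h : ℕ) : ℤ) := by
        rw [Int.natCast_natAbs]; exact_mod_cast h2
      exact_mod_cast this
    rw [← hm, Int.natAbs_mul, Int.natAbs_natCast] at h8
    exact le_trans (Nat.le_mul_of_pos_right _ hc0) h8
  have hsize : ∀ k : ℕ, k ≤ (2 ^ e) ^ h → Nat.size k ≤ e * h + 1 := by
    intro k hk
    rw [Nat.size_le]
    rw [← pow_mul] at hk
    exact lt_of_le_of_lt hk (Nat.pow_lt_pow_right (by norm_num) (by omega))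
  have h9 := hsize _ hnum
  have h10 := hsize _ (hden.trans hDh)
  rw [bitSize]
  omega

/-- The instruction respects the bounds `H a + t * G a` for the heights of the entries of the array
`a` after `t` steps. -/
def Instr.Typed (H G : ℕ → ℕ) : Instr → Prop
  | .const _ c => |c| ≤ 1
  | .copy x y => H y.name ≤ H x.name + G x.name ∧ G y.name ≤ G x.name
  | .arith .mul x y z =>
      H y.name + H z.name ≤ H x.name + G x.name ∧ G y.name + G z.name ≤ G x.name
  | .arith .div _ _ _ => False
  | .arith _ x y z =>
      (H y.name + 1 ≤ H x.name + G x.name ∧ G y.name ≤ G x.name) ∧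
        (H z.name + 1 ≤ H x.name + G x.name ∧ G z.name ≤ G x.name)
  | _ => True

/-- The rule for products excludes repeated squaring: `x := x * x` forces `G x = 0` and then `H x =
0`. An accumulator may only be multiplied by something of growth zero. -/
def Prog.Typed (H G : ℕ → ℕ) : Prog → Prop
  | .skip => True
  | .instr c => c.Typed H G
  | .seq p₁ p₂ => p₁.Typed H G ∧ p₂.Typed H G
  | .ite _ p₁ p₂ => p₁.Typed H G ∧ p₂.Typed H G
  | .loop _ p => p.Typed H G

/-- All entries of the array `a` have height at most `h a`. -/
def Store.HasHeights (D e : ℕ) (h : ℕ → ℕ) (σ : Store ℚ) : Prop :=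
  ∀ a i j, HasHeight D e (h a) (σ.arr a i j)

theorem Store.HasHeights.mono (hD : D ≤ 2 ^ e) {h h' : ℕ → ℕ} (hh : ∀ a, h a ≤ h' a) {σ : Store ℚ}
    (hσ : σ.HasHeights D e h) : σ.HasHeights D e h' :=
  fun a i j => (hσ a i j).mono hD (hh a)

theorem Store.HasHeights.write {h : ℕ → ℕ} {σ : Store ℚ} (hσ : σ.HasHeights D e h) {x : Cell} {v : ℚ}
    (hv : HasHeight D e (h x.name) v) : (σ.write x v).HasHeights D e h := by
  intro a i j
  simp only [Store.write]
  split_ifs with hc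
  · rw [hc.1]; exact hv
  · exact hσ a i j

theorem Instr.typed_exec (hD0 : 0 < D) (hD : 2 * D ≤ 2 ^ e) {H G : ℕ → ℕ} {c : Instr}
    (hc : c.Typed H G) {t : ℕ} {σ : Store ℚ} (hσ : σ.HasHeights D e fun a => H a + t * G a) :
    (c.exec σ).HasHeights D e (fun a => H a + (t + 1) * G a) ∧
      ∀ B, (∀ a, H a + (t + 1) * G a ≤ B) → c.cost bitSize σ ≤ 10 + 6 * (e * B) := by
  have hD' : D ≤ 2 ^ e := by omega
  have hσ' : σ.HasHeights D e fun a => H a + (t + 1) * G a :=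
    hσ.mono hD' fun a => by gcongr; omega
  have hsz : ∀ {h B : ℕ} {v : ℚ}, HasHeight D e h v → h ≤ B → bitSize v ≤ 3 + 2 * (e * B) :=
    fun hv hB => (hv.mono hD' hB).bitSize_le hD0 hD'
  have hB' : ∀ {B : ℕ}, (∀ a, H a + (t + 1) * G a ≤ B) → ∀ a, H a + t * G a ≤ B := by
    intro B hB a
    refine le_trans ?_ (hB a)
    gcongr; omega
  have hread : ∀ x : Cell, HasHeight D e (H x.name + t * G x.name) (σ.read x) :=
    fun x => hσ _ _ _
  -- The truncated subtraction reserves the unit of height that an addition costs.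
  have hadd : ∀ x y : ℕ, (H y + 1 ≤ H x + G x ∧ G y ≤ G x) →
      H y + t * G y ≤ H x + t * G x + G x - 1 ∧ 1 ≤ H x + t * G x + G x := by
    intro x y h
    have := Nat.mul_le_mul_left t h.2
    omega
  have hexp : ∀ x, H x + (t + 1) * G x = H x + t * G x + G x := fun x => by ring
  have harith : ∀ (o : ArithOp) (x y z : Cell),
      HasHeight D e (H x.name + (t + 1) * G x.name) (o.eval (σ.read y) (σ.read z)) →
      ((Instr.arith o x y z).exec σ).HasHeights D e (fun a => H a + (t + 1) * G a) ∧
      ∀ B, (∀ a, H a + (t + 1) * G a ≤ B) →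
        (Instr.arith o x y z).cost bitSize σ ≤ 10 + 6 * (e * B) := by
    intro o x y z h
    refine ⟨hσ'.write h, fun B hB => ?_⟩
    have h1 := hsz (hread y) (hB' hB _)
    have h2 := hsz (hread z) (hB' hB _)
    have h3 := hsz h (hB _)
    simp only [Instr.cost]
    omega
  cases c with
  | idxZero r => exact ⟨hσ', fun B _ => by simp [Instr.cost]; omega⟩
  | idxCopy r s => exact ⟨hσ', fun B _ => by simp [Instr.cost]; omega⟩
  | idxSucc r => exact ⟨hσ', fun B _ => by simp [Instr.cost]; omega⟩
  | idxPred r => exact ⟨hσ', fun B _ => by simp [Instr.cost]; omega⟩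
  | const x c =>
    have h := HasHeight.intCast (D := D) (e := e) hc
    refine ⟨hσ'.write (h.mono hD' (Nat.zero_le _)), fun B _ => ?_⟩
    have := hsz h (Nat.zero_le B)
    simp only [Instr.cost]
    omega
  | copy x y =>
    obtain ⟨h1, h2⟩ := hc
    refine ⟨hσ'.write ((hread y).mono hD' ?_), fun B hB => ?_⟩
    · have := Nat.mul_le_mul_left t h2
      rw [hexp]; omega
    · have := hsz (hread y) (hB' hB _)
      simp only [Instr.cost]
      omega
  | arith o x y z =>
    refine harith o x y z ?_
    cases o with
    | add =>
      have h1 := hadd _ _ hc.1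
      have h2 := hadd _ _ hc.2
      exact (((hread y).mono hD' h1.1).add hD ((hread z).mono hD' h2.1)).mono hD'
        (by rw [hexp]; omega)
    | sub =>
      have h1 := hadd _ _ hc.1
      have h2 := hadd _ _ hc.2
      exact (((hread y).mono hD' h1.1).sub hD ((hread z).mono hD' h2.1)).mono hD'
        (by rw [hexp]; omega)
    | mul =>
      refine ((hread y).mul (hread z)).mono hD' ?_
      obtain ⟨h1, h2⟩ := hc
      have := Nat.mul_le_mul_left t h2
      rw [Nat.mul_add] at this
      rw [hexp]; omega
    | div => exact hc.elim

/-- The unit cost serves as a clock: heights are bounded by the time elapsed, and each step costs at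
most a constant plus a multiple of the largest height. Heights and cost are bounded together since
each phase starts from the heights left by the previous one. -/
theorem Prog.cost_bitSize_le (hD0 : 0 < D) (hD : 2 * D ≤ 2 ^ e) {H G : ℕ → ℕ} {p : Prog}
    (hp : p.Typed H G) {t : ℕ} {σ : Store ℚ} (hσ : σ.HasHeights D e fun a => H a + t * G a) :
    (p.exec σ).HasHeights D e (fun a => H a + (t + p.cost unitSize σ) * G a) ∧
      ∀ B, (∀ a, H a + (t + p.cost unitSize σ) * G a ≤ B) →
        p.cost bitSize σ ≤ p.cost unitSize σ * (10 + 6 * (e * B)) := by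
  have hD' : D ≤ 2 ^ e := by omega
  have hweak : ∀ {B s s' : ℕ}, s ≤ s' → (∀ a, H a + s' * G a ≤ B) → ∀ a, H a + s * G a ≤ B :=
    fun h hB a => le_trans (by gcongr) (hB a)
  induction p generalizing t σ with
  | skip =>
    refine ⟨hσ.mono hD' fun a => by gcongr; omega, fun B _ => ?_⟩
    simp only [Prog.cost]
    omega
  | instr c =>
    have h1 : (Prog.instr c).cost unitSize σ = 1 := by
      cases c <;> simp [Prog.cost, Instr.cost, unitSize]
    simp only [h1, one_mul]
    exact Instr.typed_exec hD0 hD hp hσ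
  | seq p₁ p₂ ih₁ ih₂ =>
    obtain ⟨h1, h2⟩ := ih₁ hp.1 hσ
    obtain ⟨h3, h4⟩ := ih₂ hp.2 h1
    simp only [Prog.cost, Prog.exec, ← add_assoc]
    refine ⟨h3, fun B hB => ?_⟩
    rw [add_mul]
    exact add_le_add (h2 B (hweak (by omega) hB)) (h4 B hB)
  | ite b p₁ p₂ ih₁ ih₂ =>
    obtain ⟨h1, h2⟩ := ih₁ hp.1 hσ
    obtain ⟨h3, h4⟩ := ih₂ hp.2 hσ
    have hb1 : b.cost unitSize σ = 1 := by cases b <;> simp [Test.cost, unitSize]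
    have hb2 : ∀ B, (∀ a, H a + t * G a ≤ B) → b.cost bitSize σ ≤ 10 + 6 * (e * B) := by
      intro B hB
      cases b with
      | idxLt r s => simp only [Test.cost]; omega
      | pos x =>
        have := ((hσ x.name (σ.idx x.row) (σ.idx x.col)).mono hD' (hB _)).bitSize_le hD0 hD'
        simp only [Test.cost, Store.read]
        omega
    simp only [Prog.cost, Prog.exec, hb1]
    split_ifs with hb
    · refine ⟨h1.mono hD' fun a => by gcongr; omega, fun B hB => ?_⟩
      rw [add_mul, one_mul]
      exact add_le_add (hb2 B (hweak (by omega) hB)) (h2 B (hweak (by omega) hB))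
    · refine ⟨h3.mono hD' fun a => by gcongr; omega, fun B hB => ?_⟩
      rw [add_mul, one_mul]
      exact add_le_add (hb2 B (hweak (by omega) hB)) (h4 B (hweak (by omega) hB))
  | loop r p ih =>
    simp only [Prog.cost, Prog.exec]
    have key : ∀ k : ℕ, (p.exec^[k] σ).HasHeights D e (fun a => H a +
          (t + (1 + ∑ l ∈ Finset.range k, (1 + p.cost unitSize (p.exec^[l] σ)))) * G a) ∧
        ∀ B, (∀ a, H a +
          (t + (1 + ∑ l ∈ Finset.range k, (1 + p.cost unitSize (p.exec^[l] σ)))) * G a ≤ B) →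
        1 + ∑ l ∈ Finset.range k, (1 + p.cost bitSize (p.exec^[l] σ)) ≤
          (1 + ∑ l ∈ Finset.range k, (1 + p.cost unitSize (p.exec^[l] σ))) * (10 + 6 * (e * B)) := by
      intro k
      induction k with
      | zero =>
        refine ⟨hσ.mono hD' fun a => by gcongr; omega, fun B hB => ?_⟩
        simp only [Finset.range_zero, Finset.sum_empty]
        omega
      | succ k ihk =>
        obtain ⟨h1, h2⟩ := ih hp ihk.1
        rw [Function.iterate_succ_apply', Finset.sum_range_succ, Finset.sum_range_succ]
        refine ⟨h1.mono hD' fun a => Nat.add_le_add_left (Nat.mul_le_mul_right _ (by omega)) _,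
          fun B hB => ?_⟩
        have h3 := ihk.2 B (hweak (by omega) hB)
        have h4 := h2 B (hweak (by omega) hB)
        rw [← add_assoc, ← add_assoc, ← add_assoc, ← add_assoc, add_mul, add_mul _ 1, one_mul]
        omega
    exact key _

end BitCost

/-! ### The program -/

section Program

/-- The entry `(0, 0)` of an array, used as a scalar variable; the index register `2` is always
zero. -/
abbrev sc (a : ℕ) : Cell := ⟨a, 2, 2⟩

/-- The entry of a vector that the index register `r` points at. -/
abbrev ve (a r : ℕ) : Cell := ⟨a, r, 2⟩

abbrev setConst (x : Cell) (c : ℤ) : Prog := .instr (.const x c)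
abbrev setCopy (x y : Cell) : Prog := .instr (.copy x y)
abbrev setAdd (x y z : Cell) : Prog := .instr (.arith .add x y z)
abbrev setSub (x y z : Cell) : Prog := .instr (.arith .sub x y z)
abbrev setMul (x y z : Cell) : Prog := .instr (.arith .mul x y z)

/-- Branch on the equality of two index registers. -/
abbrev ifEq (r s : ℕ) (p₁ p₂ : Prog) : Prog :=
  .ite (.idxLt r s) p₂ (.ite (.idxLt s r) p₂ p₁)

/-- Array `7` becomes the matrix with entries `u j * M i j + t j * q i + [i = j] * v i`, where the
arrays `0, 3, 4, 5, 6` hold `M, q, u, v, t`. -/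
def buildProg : Prog :=
  forLoop 5 (forLoop 6
    (.seq (setMul (sc 20) (ve 4 6) ⟨0, 5, 6⟩)
    (.seq (setMul (sc 21) (ve 6 6) (ve 3 5))
    (.seq (setAdd (sc 22) (sc 20) (sc 21))
    (.seq (ifEq 5 6 (setCopy (sc 23) (ve 5 5)) (setConst (sc 23) 0))
      (setAdd ⟨7, 5, 6⟩ (sc 22) (sc 23)))))))

/-- Array `8` becomes the identity matrix. -/
def identityProg : Prog :=
  forLoop 5 (forLoop 6 (ifEq 5 6 (setConst ⟨8, 5, 6⟩ 1) (setConst ⟨8, 5, 6⟩ 0)))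

/-- One entry of the product of the arrays `7` and `8`. -/
def mulEntryProg : Prog :=
  .seq (setConst (sc 11) 0)
  (.seq (forLoop 7 (.seq (setMul (sc 12) ⟨7, 5, 7⟩ ⟨8, 7, 6⟩) (setAdd (sc 11) (sc 11) (sc 12))))
    (setCopy ⟨9, 5, 6⟩ (sc 11)))

/-- Array `9` becomes the product of the arrays `7` and `8`. -/
def mulProg : Prog := forLoop 5 (forLoop 6 mulEntryProg)

/-- The scalar `10` becomes the trace of the array `9`. -/
def traceProg : Prog :=
  .seq (setConst (sc 10) 0) (forLoop 5 (setAdd (sc 10) (sc 10) ⟨9, 5, 5⟩))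

/-- Array `8` becomes the scalar matrix of `10` minus a multiple of the array `9`; the factor is
found in the vector `14`. -/
def updateProg : Prog :=
  forLoop 5 (forLoop 6
    (.seq (setMul (sc 24) (ve 14 4) ⟨9, 5, 6⟩)
    (.seq (ifEq 5 6 (setCopy (sc 25) (sc 10)) (setConst (sc 25) 0))
      (setSub ⟨8, 5, 6⟩ (sc 25) (sc 24)))))

/-- The scalar `10` becomes a positive multiple of the determinant of the matrix of
`buildProg`. -/
def detProg : Prog :=
  .seq buildProg
  (.seq identityProg
  (.seq (setConst (sc 10) 1)
    (forLoop 4 (.seq mulProg (.seq traceProg updateProg)))))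

/-- The vector `14` becomes `1, 2, …, n`. -/
def countProg : Prog :=
  .seq (setConst (sc 15) 0)
  (.seq (setConst (sc 13) 1)
    (forLoop 3 (.seq (setAdd (sc 15) (sc 15) (sc 13)) (setCopy (ve 14 3) (sc 15)))))

/-- Select the columns of `M` that belong to the set in the array `s`, and the unit vectors
otherwise. -/
def selectProg (s : ℕ) : Prog :=
  forLoop 3
    (.seq (setCopy (ve 4 3) (ve s 3))
    (.seq (setSub (ve 5 3) (sc 13) (ve s 3))
      (setConst (ve 6 3) 0)))

/-- Replace the column given by the index register `3` by `q`. -/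
def replaceProg : Prog :=
  .seq (setConst (ve 4 3) 0) (.seq (setConst (ve 5 3) 0) (setConst (ve 6 3) 1))

/-- Undo `replaceProg`. -/
def restoreProg (s : ℕ) : Prog :=
  .seq (setCopy (ve 4 3) (ve s 3))
    (.seq (setSub (ve 5 3) (sc 13) (ve s 3)) (setConst (ve 6 3) 0))

/-- Cramer's rule: the scalar `d` and the vector `x` become the denominator and the numerators of
the coordinates of `q` with respect to the basis given by the set in the array `s`. -/
def cramerProg (s d x : ℕ) : Prog :=
  .seq (selectProg s)
  (.seq detProg
  (.seq (setCopy (sc d) (sc 10))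
    (forLoop 3 (.seq replaceProg (.seq detProg (.seq (setCopy (ve x 3) (sc 10)) (restoreProg s)))))))

/-- The entry of the array `a` at the index register `3` becomes the absolute value of the scalar
`b`. -/
def absProg (a b : ℕ) : Prog :=
  .ite (.pos (sc b)) (setCopy (ve a 3) (sc b)) (setSub (ve a 3) (sc 34) (sc b))

/-- The scalars `30` and `33` become multiples of the differences of the two solutions at the index
register `3`. -/
def residualProg : Prog :=
  .seq (setMul (sc 26) (sc 16) (ve 19 3))
  (.seq (setMul (sc 27) (sc 17) (ve 18 3))
  (.seq (setMul (sc 28) (sc 26) (ve 2 3))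
  (.seq (setMul (sc 29) (sc 27) (ve 1 3))
  (.seq (setSub (sc 30) (sc 28) (sc 29))
  (.seq (setSub (sc 31) (sc 27) (sc 29))
  (.seq (setSub (sc 32) (sc 26) (sc 28))
    (setSub (sc 33) (sc 31) (sc 32))))))))

/-- Change the coefficient in array `5` to one if both coefficients at the index register `3`
vanish. -/
def nonzeroProg : Prog :=
  .ite (.pos (ve 4 3)) .skip (.ite (.pos (ve 5 3)) .skip (setConst (ve 5 3) 1))

/-- The two coefficients of `combineProg` at the index register `3`. -/
def combineEntryProg : Prog :=
  .seq residualProg (.seq (absProg 4 30) (.seq (absProg 5 33) nonzeroProg))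

/-- Combine the two solutions found by `cramerProg` to a nonnegative dependence. -/
def combineProg : Prog :=
  .seq (setConst (sc 34) 0) (forLoop 3 combineEntryProg)

/-- Round the coefficients one by one to `0` or `1`, keeping the determinant nonpositive. -/
def roundProg : Prog :=
  forLoop 3
    (.seq (.seq (setConst (ve 4 3) 1) (setConst (ve 5 3) 0))
    (.seq detProg
      (.ite (.pos (sc 10)) (.seq (setConst (ve 4 3) 0) (setConst (ve 5 3) 1)) .skip)))

/-- Register `2` is zero, so the test reads the kind of the certificate; for a singular one the
output is `α` itself. -/
def minorProg : Prog :=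
  .ite (.idxLt 2 1)
    (.seq countProg (.seq (cramerProg 1 16 18) (.seq (cramerProg 2 17 19) (.seq combineProg roundProg))))
    (forLoop 3 (setCopy (ve 4 3) (ve 1 3)))

end Program

/-! ### Correctness of the determinant computation and the initializations -/

section Correctness

variable {K : Type*} [Field K] [LinearOrder K]

theorem exec_buildProg {σ : Store K} (h2 : σ.idx 2 = 0) :
    ∀ i < σ.idx 0, ∀ j < σ.idx 0, (buildProg.exec σ).arr 7 i j =
      σ.arr 4 j 0 * σ.arr 0 i j + σ.arr 6 j 0 * σ.arr 3 i 0 + if i = j then σ.arr 5 i 0 else 0 := by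
  refine exec_forLoop_forLoop (by decide) (by decide) (by decide) (by decide) (by decide) (by decide)
    (fun i j => σ.arr 4 j 0 * σ.arr 0 i j + σ.arr 6 j 0 * σ.arr 3 i 0 +
      if i = j then σ.arr 5 i 0 else 0) ?_
  intro i hi j hj τ g5 g6 hidx harr i' j'
  have g2 := (hidx 2 (by decide) (by decide) (by decide)).trans h2
  rw [← harr 0 (by decide), ← harr 3 (by decide), ← harr 4 (by decide), ← harr 5 (by decide),
    ← harr 6 (by decide)]
  rcases lt_trichotomy i j with h | h | h
  · simp [Prog.exec, Instr.exec, Store.write, Store.read, Test.eval, ArithOp.eval, g2, g5, g6, h, h.ne]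
  · simp [Prog.exec, Instr.exec, Store.write, Store.read, Test.eval, ArithOp.eval, g2, g5, g6, h]
  · simp [Prog.exec, Instr.exec, Store.write, Store.read, Test.eval, ArithOp.eval, g2, g5, g6, h, h.ne']

theorem exec_identityProg (σ : Store K) :
    ∀ i < σ.idx 0, ∀ j < σ.idx 0, (identityProg.exec σ).arr 8 i j = if i = j then 1 else 0 := by
  refine exec_forLoop_forLoop (by decide) (by decide) (by decide) (by decide) (by decide) (by decide)
    (fun i j => if i = j then 1 else 0) ?_
  intro i hi j hj τ g5 g6 hidx harr i' j'
  rcases lt_trichotomy i j with h | h | h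
  · simp [Prog.exec, Instr.exec, Store.write, Test.eval, g5, g6, h, h.ne]
  · simp [Prog.exec, Instr.exec, Store.write, Test.eval, g5, g6, h]
  · simp [Prog.exec, Instr.exec, Store.write, Test.eval, g5, g6, h, h.ne']

theorem exec_mulEntryProg {σ : Store K} (h2 : σ.idx 2 = 0) (i' j' : ℕ) :
    (mulEntryProg.exec σ).arr 9 i' j' =
      if i' = σ.idx 5 ∧ j' = σ.idx 6 then
        ∑ l ∈ Finset.range (σ.idx 0), σ.arr 7 (σ.idx 5) l * σ.arr 8 l (σ.idx 6)
      else σ.arr 9 i' j' := by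
  set τ := (setConst (sc 11) 0).exec σ with hτ
  have hτi : τ.idx = σ.idx := rfl
  set p := forLoop 7 (.seq (setMul (sc 12) ⟨7, 5, 7⟩ ⟨8, 7, 6⟩) (setAdd (sc 11) (sc 11) (sc 12))) with hp
  have key : (p.exec τ).arr 11 0 0 =
      ∑ l ∈ Finset.range (σ.idx 0), σ.arr 7 (σ.idx 5) l * σ.arr 8 l (σ.idx 6) := by
    refine exec_forLoop (by decide) (by decide) (fun k A => A 11 0 0 =
      ∑ l ∈ Finset.range k, σ.arr 7 (σ.idx 5) l * σ.arr 8 l (σ.idx 6)) ?_ ?_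
    · simp [hτ, Prog.exec, Instr.exec, Store.write, h2]
    · intro k hk υ g7 hidx harr hI
      have g2 := (hidx 2 (by decide) (by decide)).trans h2
      have g5 : υ.idx 5 = σ.idx 5 := hidx 5 (by decide) (by decide)
      have g6 : υ.idx 6 = σ.idx 6 := hidx 6 (by decide) (by decide)
      have a7 : υ.arr 7 = σ.arr 7 :=
        (harr 7 (by decide)).trans ((setConst (sc 11) 0).exec_arr (by decide) σ)
      have a8 : υ.arr 8 = σ.arr 8 :=
        (harr 8 (by decide)).trans ((setConst (sc 11) 0).exec_arr (by decide) σ)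
      rw [Finset.sum_range_succ, ← hI]
      simp [Prog.exec, Instr.exec, Store.write, Store.read, ArithOp.eval, g2, g5, g6, g7, a7, a8]
  have a9 : (p.exec τ).arr 9 = σ.arr 9 :=
    (p.exec_arr (by decide) τ).trans ((setConst (sc 11) 0).exec_arr (by decide) σ)
  have hi : ∀ r, r ∉ p.idxWrites → (p.exec τ).idx r = σ.idx r := fun r hr => p.exec_idx hr τ
  have : mulEntryProg.exec σ = (setCopy ⟨9, 5, 6⟩ (sc 11)).exec (p.exec τ) := rfl
  rw [this]
  simp [Prog.exec, Instr.exec, Store.write, Store.read, hi 5 (by decide), hi 6 (by decide),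
    hi 2 (by decide), h2, key, a9]

theorem exec_mulProg {σ : Store K} (h2 : σ.idx 2 = 0) :
    ∀ i < σ.idx 0, ∀ j < σ.idx 0, (mulProg.exec σ).arr 9 i j =
      ∑ l ∈ Finset.range (σ.idx 0), σ.arr 7 i l * σ.arr 8 l j := by
  refine exec_forLoop_forLoop (by decide) (by decide) (by decide) (by decide) (by decide) (by decide)
    (fun i j => ∑ l ∈ Finset.range (σ.idx 0), σ.arr 7 i l * σ.arr 8 l j) ?_
  intro i hi j hj τ g5 g6 hidx harr i' j'
  rw [exec_mulEntryProg ((hidx 2 (by decide) (by decide) (by decide)).trans h2), g5, g6,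
    hidx 0 (by decide) (by decide) (by decide), harr 7 (by decide), harr 8 (by decide)]

theorem exec_traceProg {σ : Store K} (h2 : σ.idx 2 = 0) :
    (traceProg.exec σ).arr 10 0 0 = ∑ l ∈ Finset.range (σ.idx 0), σ.arr 9 l l := by
  refine exec_forLoop (σ := (setConst (sc 10) 0).exec σ) (by decide) (by decide)
    (fun k A => A 10 0 0 = ∑ l ∈ Finset.range k, σ.arr 9 l l) ?_ ?_
  · simp [Prog.exec, Instr.exec, Store.write, h2]
  · intro k hk υ g5 hidx harr hI
    have g2 := (hidx 2 (by decide) (by decide)).trans h2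
    have a9 : υ.arr 9 = σ.arr 9 :=
      (harr 9 (by decide)).trans ((setConst (sc 10) 0).exec_arr (by decide) σ)
    rw [Finset.sum_range_succ, ← hI]
    simp [Prog.exec, Instr.exec, Store.write, Store.read, ArithOp.eval, g2, g5, a9]

theorem exec_updateProg {σ : Store K} (h2 : σ.idx 2 = 0) :
    ∀ i < σ.idx 0, ∀ j < σ.idx 0, (updateProg.exec σ).arr 8 i j =
      (if i = j then σ.arr 10 0 0 else 0) - σ.arr 14 (σ.idx 4) 0 * σ.arr 9 i j := by
  refine exec_forLoop_forLoop (by decide) (by decide) (by decide) (by decide) (by decide) (by decide)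
    (fun i j => (if i = j then σ.arr 10 0 0 else 0) - σ.arr 14 (σ.idx 4) 0 * σ.arr 9 i j) ?_
  intro i hi j hj τ g5 g6 hidx harr i' j'
  have g2 := (hidx 2 (by decide) (by decide) (by decide)).trans h2
  have g4 := hidx 4 (by decide) (by decide) (by decide)
  rw [← harr 9 (by decide), ← harr 10 (by decide), ← harr 14 (by decide), ← g4]
  rcases lt_trichotomy i j with h | h | h
  · simp [Prog.exec, Instr.exec, Store.write, Store.read, Test.eval, ArithOp.eval, g2, g5, g6, h, h.ne]
  · simp [Prog.exec, Instr.exec, Store.write, Store.read, Test.eval, ArithOp.eval, g2, g5, g6, h]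
  · simp [Prog.exec, Instr.exec, Store.write, Store.read, Test.eval, ArithOp.eval, g2, g5, g6, h, h.ne']

/-- One round of the Faddeev–LeVerrier recursion. -/
theorem exec_leVerrier_step {n : ℕ} {σ : Store K} (h0 : σ.idx 0 = n) (h2 : σ.idx 2 = 0)
    {A : Matrix (Fin n) (Fin n) K} (hA : ∀ i j : Fin n, σ.arr 7 i j = A i j) {k : ℕ}
    (h14 : σ.arr 14 (σ.idx 4) 0 = ((k + 1 : ℕ) : K))
    (hN : ∀ i j : Fin n, σ.arr 8 i j = (leVerrier A k).1 i j) :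
    (∀ i j : Fin n, ((Prog.seq mulProg (.seq traceProg updateProg)).exec σ).arr 8 i j =
      (leVerrier A (k + 1)).1 i j) ∧
    ((Prog.seq mulProg (.seq traceProg updateProg)).exec σ).arr 10 0 0 = (leVerrier A (k + 1)).2 := by
  set σ₁ := mulProg.exec σ with hσ₁
  set σ₂ := traceProg.exec σ₁ with hσ₂
  have i1 : ∀ r, r ∉ mulProg.idxWrites → σ₁.idx r = σ.idx r := fun r hr => mulProg.exec_idx hr σ
  have i2 : ∀ r, r ∉ traceProg.idxWrites → σ₂.idx r = σ₁.idx r := fun r hr => traceProg.exec_idx hr σ₁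
  have h9 : ∀ i j : Fin n, σ₁.arr 9 i j = (A * (leVerrier A k).1) i j := by
    intro i j
    rw [hσ₁, exec_mulProg h2 i (h0 ▸ i.2) j (h0 ▸ j.2), h0, Matrix.mul_apply, Finset.sum_range]
    exact Finset.sum_congr rfl fun l _ => by rw [hA, hN]
  have h10 : σ₂.arr 10 0 0 = (A * (leVerrier A k).1).trace := by
    rw [hσ₂, exec_traceProg ((i1 2 (by decide)).trans h2), i1 0 (by decide), h0, Finset.sum_range]
    exact Finset.sum_congr rfl fun l _ => h9 l l
  have h9' : σ₂.arr 9 = σ₁.arr 9 := traceProg.exec_arr (by decide) σ₁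
  have h14' : σ₂.arr 14 = σ.arr 14 :=
    (traceProg.exec_arr (by decide) σ₁).trans (mulProg.exec_arr (by decide) σ)
  have g0 : σ₂.idx 0 = n := ((i2 0 (by decide)).trans (i1 0 (by decide))).trans h0
  have g2 : σ₂.idx 2 = 0 := ((i2 2 (by decide)).trans (i1 2 (by decide))).trans h2
  have g4 : σ₂.idx 4 = σ.idx 4 := (i2 4 (by decide)).trans (i1 4 (by decide))
  refine ⟨fun i j => ?_, ?_⟩
  · have := exec_updateProg g2 i (g0 ▸ i.2) j (g0 ▸ j.2)
    rw [h9', h10, h14', g4, h14, h9] at this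
    refine this.trans ?_
    simp [leVerrier, Matrix.one_apply, Fin.ext_iff]
  · exact (congrFun (congrFun (updateProg.exec_arr (by decide) σ₂) 0) 0).trans h10

/-- `detProg` computes a positive multiple of the determinant. -/
theorem exec_detProg {n : ℕ} {σ : Store K} (h0 : σ.idx 0 = n) (h2 : σ.idx 2 = 0)
    (h14 : ∀ k < n, σ.arr 14 k 0 = ((k + 1 : ℕ) : K)) :
    (detProg.exec σ).arr 10 0 0 = (n.factorial : K) *
      (Matrix.of fun i j : Fin n => σ.arr 4 j 0 * σ.arr 0 i j + σ.arr 6 j 0 * σ.arr 3 i 0 +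
        if i = j then σ.arr 5 i 0 else 0).det := by
  set A := Matrix.of fun i j : Fin n => σ.arr 4 j 0 * σ.arr 0 i j + σ.arr 6 j 0 * σ.arr 3 i 0 +
        if i = j then σ.arr 5 i 0 else 0 with hA
  set σ₁ := buildProg.exec σ with hσ₁
  set σ₂ := identityProg.exec σ₁ with hσ₂
  set σ₃ := (setConst (sc 10) 1).exec σ₂ with hσ₃
  have i1 : ∀ r, r ∉ buildProg.idxWrites → σ₁.idx r = σ.idx r := fun r hr => buildProg.exec_idx hr σ
  have i2 : ∀ r, r ∉ identityProg.idxWrites → σ₂.idx r = σ₁.idx r :=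
    fun r hr => identityProg.exec_idx hr σ₁
  have g0 : σ₃.idx 0 = n := ((i2 0 (by decide)).trans (i1 0 (by decide))).trans h0
  have g2 : σ₃.idx 2 = 0 := ((i2 2 (by decide)).trans (i1 2 (by decide))).trans h2
  have f3 : ∀ a, a ≠ 10 → σ₃.arr a = σ₂.arr a := fun a ha =>
    (setConst (sc 10) 1).exec_arr (by simpa [Prog.arrWrites, Instr.arrWrites] using ha) σ₂
  have h7 : ∀ i j : Fin n, σ₃.arr 7 i j = A i j := by
    intro i j
    rw [f3 7 (by decide), hσ₂, identityProg.exec_arr (by decide) σ₁, hσ₁,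
      exec_buildProg h2 i (h0 ▸ i.2) j (h0 ▸ j.2), hA]
    simp [Fin.ext_iff]
  have h8 : ∀ i j : Fin n, σ₃.arr 8 i j = (1 : Matrix (Fin n) (Fin n) K) i j := by
    intro i j
    have e : σ₁.idx 0 = n := (i1 0 (by decide)).trans h0
    rw [f3 8 (by decide), hσ₂, exec_identityProg σ₁ i (e ▸ i.2) j (e ▸ j.2)]
    simp [Matrix.one_apply, Fin.ext_iff]
  have h14' : σ₃.arr 14 = σ.arr 14 := by
    rw [f3 14 (by decide), hσ₂, identityProg.exec_arr (by decide) σ₁, hσ₁,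
      buildProg.exec_arr (by decide) σ]
  have h10 : σ₃.arr 10 0 0 = 1 := by
    have e : σ₂.idx 2 = 0 := g2
    simp [hσ₃, Prog.exec, Instr.exec, Store.write, e]
  have key := exec_forLoop (p := .seq mulProg (.seq traceProg updateProg)) (r := 4) (σ := σ₃)
    (by decide) (by decide)
    (fun k B => (∀ i j : Fin n, B 8 i j = (leVerrier A k).1 i j) ∧ B 10 0 0 = (leVerrier A k).2)
    ⟨h8, h10⟩ (by
      intro k hk τ k4 hidx harr hI
      refine exec_leVerrier_step ((hidx 0 (by decide) (by decide)).trans g0)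
        ((hidx 2 (by decide) (by decide)).trans g2) ?_ ?_ hI.1
      · intro i j
        rw [harr 7 (by decide), h7]
      · rw [harr 14 (by decide), h14', k4, h14 k (g0 ▸ hk)])
  have := key.2
  rw [g0] at this
  have hc := leVerrier_card A
  rw [Fintype.card_fin] at hc
  exact this.trans hc

theorem exec_countProg {σ : Store K} (h2 : σ.idx 2 = 0) :
    ∀ k < σ.idx 0, (countProg.exec σ).arr 14 k 0 = ((k + 1 : ℕ) : K) := by
  set τ := (setConst (sc 13) 1).exec ((setConst (sc 15) 0).exec σ) with hτ
  have h := exec_forLoop (p := .seq (setAdd (sc 15) (sc 15) (sc 13)) (setCopy (ve 14 3) (sc 15)))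
    (r := 3) (σ := τ) (by decide) (by decide)
    (fun k A => A 15 0 0 = (k : K) ∧ ∀ i < k, A 14 i 0 = ((i + 1 : ℕ) : K)) (by
      refine ⟨?_, by simp⟩
      simp [hτ, Prog.exec, Instr.exec, Store.write, h2]) (by
      intro k hk υ g3 hidx harr hI
      have g2 := (hidx 2 (by decide) (by decide)).trans h2
      have a13 : υ.arr 13 0 0 = 1 := by
        rw [harr 13 (by decide)]
        simp [hτ, Prog.exec, Instr.exec, Store.write, h2]
      refine ⟨?_, fun i hi => ?_⟩
      · simp [Prog.exec, Instr.exec, Store.write, Store.read, ArithOp.eval, g2, g3, hI.1, a13]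
      · rcases Nat.lt_succ_iff_lt_or_eq.1 hi with hi | rfl
        · simp [Prog.exec, Instr.exec, Store.write, Store.read, ArithOp.eval, g2, g3, hi.ne, hI.2 i hi]
        · simp [Prog.exec, Instr.exec, Store.write, Store.read, ArithOp.eval, g2, g3, hI.1, a13])
  exact h.2

theorem exec_countProg_one {σ : Store K} (h2 : σ.idx 2 = 0) : (countProg.exec σ).arr 13 0 0 = 1 := by
  set τ := (setConst (sc 13) 1).exec ((setConst (sc 15) 0).exec σ) with hτ
  have : countProg.exec σ =
    (forLoop 3 (.seq (setAdd (sc 15) (sc 15) (sc 13)) (setCopy (ve 14 3) (sc 15)))).exec τ := rfl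
  rw [this, Prog.exec_arr _ (by decide)]
  simp [hτ, Prog.exec, Instr.exec, Store.write, h2]

theorem exec_selectProg {s : ℕ} (hs : s = 1 ∨ s = 2) {σ : Store K} (h2 : σ.idx 2 = 0) :
    ∀ i < σ.idx 0, ((selectProg s).exec σ).arr 4 i 0 = σ.arr s i 0 ∧
      ((selectProg s).exec σ).arr 5 i 0 = σ.arr 13 0 0 - σ.arr s i 0 ∧
      ((selectProg s).exec σ).arr 6 i 0 = 0 := by
  refine exec_forLoop (by decide) (by rcases hs with rfl | rfl <;> decide)
    (fun k A => ∀ i < k, A 4 i 0 = σ.arr s i 0 ∧ A 5 i 0 = σ.arr 13 0 0 - σ.arr s i 0 ∧ A 6 i 0 = 0)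
    (by simp) ?_
  intro k hk υ g3 hidx harr hI
  have g2 := (hidx 2 (by decide) (by rcases hs with rfl | rfl <;> decide)).trans h2
  have as : υ.arr s = σ.arr s := harr s (by rcases hs with rfl | rfl <;> decide)
  have a13 : υ.arr 13 = σ.arr 13 := harr 13 (by rcases hs with rfl | rfl <;> decide)
  have hs4 : s ≠ 4 := by rcases hs with rfl | rfl <;> decide
  intro i hi
  rcases Nat.lt_succ_iff_lt_or_eq.1 hi with hi | rfl
  · simp [Prog.exec, Instr.exec, Store.write, Store.read, ArithOp.eval, g2, g3, hi.ne, hI i hi]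
  · simp [Prog.exec, Instr.exec, Store.write, Store.read, ArithOp.eval, g2, g3, as, a13, hs4]

end Correctness

/-! ### Correctness of Cramer's rule, the combination and the rounding -/

section Correctness

variable {K : Type*} [Field K] [LinearOrder K]

theorem exec_detProg_mixMatrix {n : ℕ} {σ : Store K} (h0 : σ.idx 0 = n) (h2 : σ.idx 2 = 0)
    (h14 : ∀ k < n, σ.arr 14 k 0 = ((k + 1 : ℕ) : K)) {M : Matrix (Fin n) (Fin n) K}
    (hM : ∀ i j : Fin n, σ.arr 0 i j = M i j) {u v : Fin n → K} (hu : ∀ i : Fin n, σ.arr 4 i 0 = u i)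
    (hv : ∀ i : Fin n, σ.arr 5 i 0 = v i) (ht : ∀ i : Fin n, σ.arr 6 i 0 = 0) :
    (detProg.exec σ).arr 10 0 0 = (n.factorial : K) * (mixMatrix M u v).det := by
  rw [exec_detProg h0 h2 h14]
  congr 2
  ext i j
  simp only [Matrix.of_apply, mixMatrix, hM, hu, hv, ht]
  by_cases h : i = j <;> simp [h]

theorem exec_cramerProg {n s d x : ℕ} (hs : s = 1 ∨ s = 2)
    (hdx : d = 16 ∧ x = 18 ∨ d = 17 ∧ x = 19) {σ : Store K} (h0 : σ.idx 0 = n) (h2 : σ.idx 2 = 0)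
    (h13 : σ.arr 13 0 0 = 1) (h14 : ∀ k < n, σ.arr 14 k 0 = ((k + 1 : ℕ) : K))
    {M : Matrix (Fin n) (Fin n) K} (hM : ∀ i j : Fin n, σ.arr 0 i j = M i j)
    {q : Fin n → K} (hq : ∀ i : Fin n, σ.arr 3 i 0 = q i) :
    ((cramerProg s d x).exec σ).arr d 0 0 = (n.factorial : K) *
        (mixMatrix M (fun i => σ.arr s i 0) fun i => 1 - σ.arr s i 0).det ∧
      (∀ i : Fin n, ((cramerProg s d x).exec σ).arr x i 0 = (n.factorial : K) *
        (mixMatrix M (fun i => σ.arr s i 0) fun i => 1 - σ.arr s i 0).cramer q i) ∧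
      ∀ i : Fin n, ((cramerProg s d x).exec σ).arr 6 i 0 = 0 := by
  set B := mixMatrix M (fun i => σ.arr s i 0) fun i => 1 - σ.arr s i 0 with hB
  set σ₁ := (selectProg s).exec σ with hσ₁
  set σ₂ := detProg.exec σ₁ with hσ₂
  set σ₃ := (setCopy (sc d) (sc 10)).exec σ₂ with hσ₃
  set body := Prog.seq replaceProg
    (.seq detProg (.seq (setCopy (ve x 3) (sc 10)) (restoreProg s))) with hbody
  have hex : (cramerProg s d x).exec σ = (forLoop 3 body).exec σ₃ := rfl
  have w1 : ∀ a, a ≠ 4 → a ≠ 5 → a ≠ 6 → σ₁.arr a = σ.arr a := fun a h4 h5 h6 =>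
    (selectProg s).exec_arr (by
      simp [selectProg, forLoop, Prog.arrWrites, Instr.arrWrites, h4, h5, h6]) σ
  -- The registers written do not depend on `s`; taking `0` for `s` makes the condition closed,
  -- hence decidable.
  have i1 : ∀ r, r ∉ (selectProg 0).idxWrites → σ₁.idx r = σ.idx r :=
    fun r hr => (selectProg s).exec_idx hr σ
  have i2 : ∀ r, r ∉ detProg.idxWrites → σ₂.idx r = σ₁.idx r := fun r hr => detProg.exec_idx hr σ₁
  have g0 : σ₁.idx 0 = n := (i1 0 (by decide)).trans h0
  have g2 : σ₁.idx 2 = 0 := (i1 2 (by decide)).trans h2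
  have g0' : σ₃.idx 0 = n := (i2 0 (by decide)).trans g0
  have g2' : σ₃.idx 2 = 0 := (i2 2 (by decide)).trans g2
  have sel := exec_selectProg hs h2 (σ := σ)
  rw [h0, h13] at sel
  have hdet : σ₂.arr 10 0 0 = (n.factorial : K) * B.det := by
    refine exec_detProg_mixMatrix g0 g2 (fun k hk => ?_) (fun i j => ?_) (fun i => (sel i i.2).1)
      (fun i => (sel i i.2).2.1) (fun i => (sel i i.2).2.2)
    · rw [w1 14 (by decide) (by decide) (by decide), h14 k hk]
    · rw [w1 0 (by decide) (by decide) (by decide), hM]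
  have w3 : ∀ a, a ≠ d → σ₃.arr a = σ₂.arr a := fun a ha =>
    (setCopy (sc d) (sc 10)).exec_arr (by simpa [Prog.arrWrites, Instr.arrWrites] using ha) σ₂
  have f3 : ∀ a, a ≠ d → a ∉ detProg.arrWrites → σ₃.arr a = σ₁.arr a := fun a ha hd =>
    (w3 a ha).trans (detProg.exec_arr hd σ₁)
  have fσ : ∀ a, a ≠ d → a ≠ 4 → a ≠ 5 → a ≠ 6 → a ∉ detProg.arrWrites → σ₃.arr a = σ.arr a :=
    fun a ha h4 h5 h6 hd => (f3 a ha hd).trans (w1 a h4 h5 h6)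
  have hd3 : σ₃.arr d 0 0 = (n.factorial : K) * B.det := by
    have e : σ₂.idx 2 = 0 := g2'
    rw [← hdet]
    simp [hσ₃, Prog.exec, Instr.exec, Store.write, Store.read, e]
  have hdb : d ∉ body.arrWrites := by
    rw [hbody]
    rcases hs with rfl | rfl <;> rcases hdx with ⟨rfl, rfl⟩ | ⟨rfl, rfl⟩ <;> decide
  have h0b : ∀ r, r = 0 ∨ r = 2 ∨ r = 3 → r ∉ body.idxWrites := by
    rw [hbody]
    rcases hs with rfl | rfl <;> rcases hdx with ⟨rfl, rfl⟩ | ⟨rfl, rfl⟩ <;>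
      rintro r (rfl | rfl | rfl) <;> decide
  have hab : ∀ a, a = 0 ∨ a = 3 ∨ a = 13 ∨ a = 14 ∨ a = s → a ∉ body.arrWrites ∧ a ≠ d ∧ a ≠ 4 ∧
      a ≠ 5 ∧ a ≠ 6 ∧ a ∉ detProg.arrWrites := by
    rw [hbody]
    rcases hs with rfl | rfl <;> rcases hdx with ⟨rfl, rfl⟩ | ⟨rfl, rfl⟩ <;>
      rintro a (rfl | rfl | rfl | rfl | rfl) <;> decide
  have hx : x ≠ 4 ∧ x ≠ 5 ∧ x ≠ 6 ∧ x ≠ s ∧ x ≠ 13 ∧ x ∉ detProg.arrWrites ∧ s ≠ 4 ∧ s ≠ 5 ∧ s ≠ x := by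
    rcases hs with rfl | rfl <;> rcases hdx with ⟨rfl, rfl⟩ | ⟨rfl, rfl⟩ <;> decide
  -- Invariant: between iterations the coefficient vectors again describe the unmodified basis, and
  -- the numerators computed so far are correct.
  have key := exec_forLoop (p := body) (r := 3) (σ := σ₃) (by decide) (h0b 3 (by simp))
    (fun k A => (∀ i < n, A 4 i 0 = σ.arr s i 0 ∧ A 5 i 0 = 1 - σ.arr s i 0 ∧ A 6 i 0 = 0) ∧
      ∀ i : Fin n, i.1 < k → A x i 0 = (n.factorial : K) * B.cramer q i)
    ⟨fun i hi => by
      rw [f3 4 (by rcases hdx with ⟨rfl, rfl⟩ | ⟨rfl, rfl⟩ <;> decide) (by decide),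
        f3 5 (by rcases hdx with ⟨rfl, rfl⟩ | ⟨rfl, rfl⟩ <;> decide) (by decide),
        f3 6 (by rcases hdx with ⟨rfl, rfl⟩ | ⟨rfl, rfl⟩ <;> decide) (by decide)]
      exact sel i hi, by simp⟩ (by
      intro k hk τ g3 hidx harr hI
      have hfr : ∀ a, a = 0 ∨ a = 3 ∨ a = 13 ∨ a = 14 ∨ a = s → τ.arr a = σ.arr a := by
        intro a ha
        obtain ⟨h1, h3, h4, h5, h6, h7⟩ := hab a ha
        exact (harr a h1).trans (fσ a h3 h4 h5 h6 h7)
      have t0 : τ.idx 0 = n := (hidx 0 (by decide) (h0b 0 (by simp))).trans g0'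
      have t2 : τ.idx 2 = 0 := (hidx 2 (by decide) (h0b 2 (by simp))).trans g2'
      rw [g0'] at hk
      set τ₁ := replaceProg.exec τ with hτ₁
      set τ₂ := detProg.exec τ₁ with hτ₂
      have j1 : τ₁.idx = τ.idx := rfl
      have a4 : ∀ i, τ₁.arr 4 i 0 = if i = k then 0 else τ.arr 4 i 0 := fun i => by
        simp [hτ₁, replaceProg, Prog.exec, Instr.exec, Store.write, t2, g3]
      have a5 : ∀ i, τ₁.arr 5 i 0 = if i = k then 0 else τ.arr 5 i 0 := fun i => by
        simp [hτ₁, replaceProg, Prog.exec, Instr.exec, Store.write, t2, g3]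
      have a6 : ∀ i, τ₁.arr 6 i 0 = if i = k then 1 else τ.arr 6 i 0 := fun i => by
        simp [hτ₁, replaceProg, Prog.exec, Instr.exec, Store.write, t2, g3]
      have b : ∀ a, a ∉ replaceProg.arrWrites → τ₁.arr a = τ.arr a := fun a ha =>
        replaceProg.exec_arr ha τ
      -- Coefficients `(0, 0, 1)` in column `k` turn that column into `q`, giving the matrix of
      -- Cramer's rule.
      have hdet : τ₂.arr 10 0 0 = (n.factorial : K) * B.cramer q ⟨k, hk⟩ := by
        rw [hτ₂, exec_detProg (by rw [j1, t0]) (by rw [j1, t2]) (fun l hl => by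
          rw [b 14 (by decide), hfr 14 (by simp), h14 l hl]), Matrix.cramer_apply]
        congr 2
        ext i j
        obtain ⟨c4, c5, c6⟩ := hI.1 j j.2
        simp only [Matrix.of_apply, b 0 (by decide), b 3 (by decide), hfr 0 (by simp),
          hfr 3 (by simp), hM, hq, a4, a5, a6]
        by_cases hj : j = ⟨k, hk⟩
        · have hjk : (j : ℕ) = k := by rw [hj]
          subst hj
          by_cases hi : i = ⟨k, hk⟩
          · simp [hi]
          · have : (i : ℕ) ≠ k := fun h => hi (Fin.ext h)
            simp [hi]
        · have hjk : (j : ℕ) ≠ k := fun h => hj (Fin.ext h)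
          rw [Matrix.updateCol_ne hj, if_neg hjk, if_neg hjk, c4, c6]
          by_cases hij : i = j
          · subst hij
            simp [hB, mixMatrix, hjk, c5]
          · simp [hB, mixMatrix, hij]
      have e3 : τ₂.idx 3 = k := (detProg.exec_idx (by decide) τ₁).trans g3
      have e2 : τ₂.idx 2 = 0 := (detProg.exec_idx (by decide) τ₁).trans t2
      have d4 : τ₂.arr 4 = τ₁.arr 4 := detProg.exec_arr (by decide) τ₁
      have d5 : τ₂.arr 5 = τ₁.arr 5 := detProg.exec_arr (by decide) τ₁
      have d6 : τ₂.arr 6 = τ₁.arr 6 := detProg.exec_arr (by decide) τ₁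
      have dx : τ₂.arr x = τ.arr x := (detProg.exec_arr hx.2.2.2.2.2.1 τ₁).trans
        (b x (by simp [replaceProg, Prog.arrWrites, Instr.arrWrites, hx.1, hx.2.1, hx.2.2.1]))
      have ds : τ₂.arr s = σ.arr s := by
        rw [hτ₂, detProg.exec_arr (hab s (by simp)).2.2.2.2.2 τ₁, b s (by
          rcases hs with rfl | rfl <;> decide), hfr s (by simp)]
      have d13 : τ₂.arr 13 0 0 = 1 := by
        rw [hτ₂, detProg.exec_arr (by decide) τ₁, b 13 (by decide), hfr 13 (by simp), h13]
      have hfin : body.exec τ = (restoreProg s).exec ((setCopy (ve x 3) (sc 10)).exec τ₂) := rfl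
      obtain ⟨x4, x5, x6, xs, x13, -, s4, s5, sx⟩ := hx
      rw [hfin]
      refine ⟨fun i hi => ?_, fun i hi => ?_⟩
      · obtain ⟨c4, c5, c6⟩ := hI.1 i hi
        by_cases hik : i = k
        · subst hik
          simp [restoreProg, Prog.exec, Instr.exec, Store.write, Store.read, ArithOp.eval, e2, e3, s4,
            sx, x13.symm, ds, d13]
        · simp [restoreProg, Prog.exec, Instr.exec, Store.write, Store.read, ArithOp.eval, e2, e3, s4,
            sx, x4.symm, x5.symm, x6.symm, x13.symm, hik, d4, d5, d6, a4, a5, a6, c4, c5, c6]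
      · rcases Nat.lt_succ_iff_lt_or_eq.1 hi with hi | hi
        · simp [restoreProg, Prog.exec, Instr.exec, Store.write, Store.read, ArithOp.eval, e2, e3,
            x4, x5, x6, hi.ne, dx, hI.2 i hi]
        · have : i = ⟨k, hk⟩ := Fin.ext hi
          simp [restoreProg, Prog.exec, Instr.exec, Store.write, Store.read, ArithOp.eval, e2, e3,
            x4, x5, x6, this, hdet])
  rw [g0'] at key
  rw [hex]
  refine ⟨?_, fun i => key.2 i i.2, fun i => (key.1 i i.2).2.2⟩
  rw [Prog.exec_arr (forLoop 3 body) (by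
    simpa [forLoop, Prog.arrWrites, Instr.arrWrites] using hdb), hd3]

theorem exec_scalar_arith {o : ArithOp} {x : ℕ} {y z : Cell} {σ τ : Store K} (h2 : σ.idx 2 = 0)
    (hτ : τ = (Prog.instr (.arith o (sc x) y z)).exec σ) (a i j : ℕ) :
    τ.arr a i j = if a = x ∧ i = 0 ∧ j = 0 then
      o.eval (σ.arr y.name (σ.idx y.row) (σ.idx y.col)) (σ.arr z.name (σ.idx z.row) (σ.idx z.col))
      else σ.arr a i j := by
  rw [hτ]
  simp [Prog.exec, Instr.exec, Store.write, Store.read, h2]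

theorem exec_residualProg {σ : Store K} (h2 : σ.idx 2 = 0) :
    (residualProg.exec σ).arr 30 0 0 = σ.arr 16 0 0 * σ.arr 19 (σ.idx 3) 0 * σ.arr 2 (σ.idx 3) 0 -
        σ.arr 17 0 0 * σ.arr 18 (σ.idx 3) 0 * σ.arr 1 (σ.idx 3) 0 ∧
      (residualProg.exec σ).arr 33 0 0 =
        (σ.arr 17 0 0 * σ.arr 18 (σ.idx 3) 0 -
          σ.arr 17 0 0 * σ.arr 18 (σ.idx 3) 0 * σ.arr 1 (σ.idx 3) 0) -
        (σ.arr 16 0 0 * σ.arr 19 (σ.idx 3) 0 -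
          σ.arr 16 0 0 * σ.arr 19 (σ.idx 3) 0 * σ.arr 2 (σ.idx 3) 0) := by
  -- The intermediate memories are made opaque, so that their unfolded terms do not nest.
  obtain ⟨σ₁, e1⟩ : ∃ τ, τ = (setMul (sc 26) (sc 16) (ve 19 3)).exec σ := ⟨_, rfl⟩
  have g1 : ∀ r, σ₁.idx r = σ.idx r := fun r => by rw [e1]; rfl
  have a1 := exec_scalar_arith h2 e1
  obtain ⟨σ₂, e2⟩ : ∃ τ, τ = (setMul (sc 27) (sc 17) (ve 18 3)).exec σ₁ := ⟨_, rfl⟩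
  have g2 : ∀ r, σ₂.idx r = σ.idx r := fun r => by rw [e2, ← g1]; rfl
  have a2 := exec_scalar_arith ((g1 2).trans h2) e2
  obtain ⟨σ₃, e3⟩ : ∃ τ, τ = (setMul (sc 28) (sc 26) (ve 2 3)).exec σ₂ := ⟨_, rfl⟩
  have g3 : ∀ r, σ₃.idx r = σ.idx r := fun r => by rw [e3, ← g2]; rfl
  have a3 := exec_scalar_arith ((g2 2).trans h2) e3
  obtain ⟨σ₄, e4⟩ : ∃ τ, τ = (setMul (sc 29) (sc 27) (ve 1 3)).exec σ₃ := ⟨_, rfl⟩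
  have g4 : ∀ r, σ₄.idx r = σ.idx r := fun r => by rw [e4, ← g3]; rfl
  have a4 := exec_scalar_arith ((g3 2).trans h2) e4
  obtain ⟨σ₅, e5⟩ : ∃ τ, τ = (setSub (sc 30) (sc 28) (sc 29)).exec σ₄ := ⟨_, rfl⟩
  have g5 : ∀ r, σ₅.idx r = σ.idx r := fun r => by rw [e5, ← g4]; rfl
  have a5 := exec_scalar_arith ((g4 2).trans h2) e5
  obtain ⟨σ₆, e6⟩ : ∃ τ, τ = (setSub (sc 31) (sc 27) (sc 29)).exec σ₅ := ⟨_, rfl⟩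
  have g6 : ∀ r, σ₆.idx r = σ.idx r := fun r => by rw [e6, ← g5]; rfl
  have a6 := exec_scalar_arith ((g5 2).trans h2) e6
  obtain ⟨σ₇, e7⟩ : ∃ τ, τ = (setSub (sc 32) (sc 26) (sc 28)).exec σ₆ := ⟨_, rfl⟩
  have g7 : ∀ r, σ₇.idx r = σ.idx r := fun r => by rw [e7, ← g6]; rfl
  have a7 := exec_scalar_arith ((g6 2).trans h2) e7
  obtain ⟨σ₈, e8⟩ : ∃ τ, τ = (setSub (sc 33) (sc 31) (sc 32)).exec σ₇ := ⟨_, rfl⟩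
  have g8 : ∀ r, σ₈.idx r = σ.idx r := fun r => by rw [e8, ← g7]; rfl
  have a8 := exec_scalar_arith ((g7 2).trans h2) e8
  have hex : residualProg.exec σ = σ₈ := by
    simp only [residualProg, Prog.exec.eq_3, ← e1, ← e2, ← e3, ← e4, ← e5, ← e6, ← e7, ← e8]
  rw [hex]
  constructor <;>
    simp [a1, a2, a3, a4, a5, a6, a7, a8, g1, g2, g3, g4, g5, g6, g7, h2, ArithOp.eval]

/-- For nonnegative entries a failed positivity test means zero. -/
theorem exec_nonzeroProg {σ : Store K} (h2 : σ.idx 2 = 0) (h4 : 0 ≤ σ.arr 4 (σ.idx 3) 0)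
    (h5 : 0 ≤ σ.arr 5 (σ.idx 3) 0) (i : ℕ) :
    (nonzeroProg.exec σ).arr 4 i 0 = σ.arr 4 i 0 ∧
      (nonzeroProg.exec σ).arr 5 i 0 =
        if i = σ.idx 3 ∧ σ.arr 4 (σ.idx 3) 0 = 0 ∧ σ.arr 5 (σ.idx 3) 0 = 0 then 1
        else σ.arr 5 i 0 := by
  rcases h4.lt_or_eq with h4 | h4
  · simp [nonzeroProg, Prog.exec, Test.eval, Store.read, h2, h4, h4.ne']
  · rcases h5.lt_or_eq with h5 | h5
    · simp [nonzeroProg, Prog.exec, Test.eval, Store.read, h2, ← h4, h5, h5.ne']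
    · simp [nonzeroProg, Prog.exec, Test.eval, Store.read, Instr.exec, Store.write, h2, ← h4, ← h5]

variable [IsStrictOrderedRing K]

theorem exec_absProg {a b : ℕ} {σ : Store K} (h2 : σ.idx 2 = 0) (h34 : σ.arr 34 0 0 = 0)
    (c i j : ℕ) : ((absProg a b).exec σ).arr c i j =
      if c = a ∧ i = σ.idx 3 ∧ j = 0 then |σ.arr b 0 0| else σ.arr c i j := by
  by_cases h : 0 < σ.arr b 0 0
  · simp [absProg, Prog.exec, Instr.exec, Store.write, Store.read, Test.eval, h2, h, abs_of_pos]
  · simp [absProg, Prog.exec, Instr.exec, Store.write, Store.read, Test.eval, ArithOp.eval, h2, h, h34,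
      abs_of_nonpos (not_lt.1 h)]

theorem exec_combineEntryProg {σ : Store K} (h2 : σ.idx 2 = 0) (h34 : σ.arr 34 0 0 = 0) {z w : K}
    (hz : (residualProg.exec σ).arr 30 0 0 = z) (hw : (residualProg.exec σ).arr 33 0 0 = w) (i : ℕ) :
    (combineEntryProg.exec σ).arr 4 i 0 = (if i = σ.idx 3 then |z| else σ.arr 4 i 0) ∧
      (combineEntryProg.exec σ).arr 5 i 0 =
        if i = σ.idx 3 then if z = 0 ∧ w = 0 then 1 else |w| else σ.arr 5 i 0 := by
  have hex : combineEntryProg.exec σ = nonzeroProg.exec ((absProg 5 33).exec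
    ((absProg 4 30).exec (residualProg.exec σ))) := by simp only [combineEntryProg, Prog.exec]
  obtain ⟨τ₁, hτ₁⟩ : ∃ υ, υ = residualProg.exec σ := ⟨_, rfl⟩
  obtain ⟨τ₂, hτ₂⟩ : ∃ υ, υ = (absProg 4 30).exec τ₁ := ⟨_, rfl⟩
  obtain ⟨τ₃, hτ₃⟩ : ∃ υ, υ = (absProg 5 33).exec τ₂ := ⟨_, rfl⟩
  have hi : ∀ a b r, r ∉ (absProg a b).idxWrites := fun a b r => by
    simp [absProg, Prog.idxWrites, Instr.idxWrites]
  have j1 : ∀ r, τ₁.idx r = σ.idx r := fun r => by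
    rw [hτ₁, residualProg.exec_idx (by simp [residualProg, Prog.idxWrites, Instr.idxWrites])]
  have j2 : ∀ r, τ₂.idx r = σ.idx r := fun r => by rw [hτ₂, Prog.exec_idx _ (hi _ _ _), j1]
  have j3 : ∀ r, τ₃.idx r = σ.idx r := fun r => by rw [hτ₃, Prog.exec_idx _ (hi _ _ _), j2]
  have fr : ∀ a, a = 4 ∨ a = 5 ∨ a = 34 → τ₁.arr a = σ.arr a := fun a ha => by
    rw [hτ₁]
    rcases ha with rfl | rfl | rfl <;> exact residualProg.exec_arr (by decide) σ
  rw [← hτ₁] at hz hw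
  have e2 := exec_absProg (a := 4) (b := 30) (σ := τ₁) (by rw [j1, h2]) (by rw [fr 34 (by simp), h34])
  rw [← hτ₂, hz, j1] at e2
  have e3 := exec_absProg (a := 5) (b := 33) (σ := τ₂) (by rw [j2, h2]) (by
    rw [e2, if_neg (by simp), fr 34 (by simp), h34])
  rw [← hτ₃, j2, e2, if_neg (by simp), hw] at e3
  have u4 : ∀ i, τ₃.arr 4 i 0 = if i = σ.idx 3 then |z| else σ.arr 4 i 0 := fun i => by
    rw [e3, if_neg (by simp), e2, fr 4 (by simp)]
    simp
  have u5 : ∀ i, τ₃.arr 5 i 0 = if i = σ.idx 3 then |w| else σ.arr 5 i 0 := fun i => by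
    rw [e3, e2, fr 5 (by simp)]
    simp
  have v4 := u4 (σ.idx 3)
  have v5 := u5 (σ.idx 3)
  rw [if_pos rfl] at v4 v5
  have key := exec_nonzeroProg (σ := τ₃) (by rw [j3, h2]) (by rw [j3, v4]; exact abs_nonneg z)
    (by rw [j3, v5]; exact abs_nonneg w) i
  rw [j3, v4, v5, u4, u5] at key
  rw [hex, ← hτ₁, ← hτ₂, ← hτ₃, key.1, key.2]
  refine ⟨rfl, ?_⟩
  by_cases h : i = σ.idx 3 <;> simp [h]

theorem exec_combineProg {σ : Store K} (h2 : σ.idx 2 = 0) {Z W : ℕ → K}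
    (hZ : ∀ i, Z i = σ.arr 16 0 0 * σ.arr 19 i 0 * σ.arr 2 i 0 -
      σ.arr 17 0 0 * σ.arr 18 i 0 * σ.arr 1 i 0)
    (hW : ∀ i, W i = (σ.arr 17 0 0 * σ.arr 18 i 0 - σ.arr 17 0 0 * σ.arr 18 i 0 * σ.arr 1 i 0) -
      (σ.arr 16 0 0 * σ.arr 19 i 0 - σ.arr 16 0 0 * σ.arr 19 i 0 * σ.arr 2 i 0)) :
    ∀ i < σ.idx 0, (combineProg.exec σ).arr 4 i 0 = |Z i| ∧
      (combineProg.exec σ).arr 5 i 0 = if Z i = 0 ∧ W i = 0 then 1 else |W i| := by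
  refine exec_forLoop (σ := (setConst (sc 34) 0).exec σ) (by decide) (by decide)
    (fun k A => ∀ i < k, A 4 i 0 = |Z i| ∧ A 5 i 0 = if Z i = 0 ∧ W i = 0 then 1 else |W i|)
    (by simp) ?_
  intro k hk τ g3 hidx harr hI
  have g2 : τ.idx 2 = 0 := (hidx 2 (by decide) (by decide)).trans h2
  have h34 : τ.arr 34 0 0 = 0 := by
    rw [harr 34 (by decide)]
    simp [Prog.exec, Instr.exec, Store.write, h2]
  have fr : ∀ a, a = 1 ∨ a = 2 ∨ a = 16 ∨ a = 17 ∨ a = 18 ∨ a = 19 → τ.arr a = σ.arr a := by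
    rintro a (rfl | rfl | rfl | rfl | rfl | rfl) <;>
      exact (harr _ (by decide)).trans ((setConst (sc 34) 0).exec_arr (by decide) σ)
  obtain ⟨r1, r2⟩ := exec_residualProg g2
  rw [g3, fr 1 (by simp), fr 2 (by simp), fr 16 (by simp), fr 17 (by simp), fr 18 (by simp),
    fr 19 (by simp)] at r1 r2
  intro i hi
  have key := exec_combineEntryProg g2 h34 (r1.trans (hZ k).symm) (r2.trans (hW k).symm) i
  rw [g3] at key
  rw [key.1, key.2]
  by_cases h : i = k
  · simp [h]
  · rw [if_neg h, if_neg h]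
    exact hI i (by omega)

/-- The rounding phase keeps the determinant nonpositive. -/
theorem exec_roundProg {n : ℕ} {σ : Store K} (h0 : σ.idx 0 = n) (h2 : σ.idx 2 = 0)
    (h14 : ∀ k < n, σ.arr 14 k 0 = ((k + 1 : ℕ) : K)) {M : Matrix (Fin n) (Fin n) K}
    (hM : ∀ i j : Fin n, σ.arr 0 i j = M i j) (ht : ∀ i : Fin n, σ.arr 6 i 0 = 0)
    (hu : ∀ i : Fin n, 0 ≤ σ.arr 4 i 0) (hv : ∀ i : Fin n, 0 ≤ σ.arr 5 i 0)
    (huv : ∀ i : Fin n, σ.arr 4 i 0 ≠ 0 ∨ σ.arr 5 i 0 ≠ 0)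
    (hdet : (mixMatrix M (fun i => σ.arr 4 i 0) fun i => σ.arr 5 i 0).det ≤ 0) :
    IsNonposMinor M (outputSet n (roundProg.exec σ)) := by
  set body : Prog := .seq (.seq (setConst (ve 4 3) 1) (setConst (ve 5 3) 0))
    (.seq detProg
      (.ite (.pos (sc 10)) (.seq (setConst (ve 4 3) 0) (setConst (ve 5 3) 1)) .skip)) with hbody
  -- Invariant: all pairs are nonnegative and nonzero, the determinant is nonpositive, and the pairs
  -- already treated are `(1, 0)` or `(0, 1)`.
  have key := exec_forLoop (p := body) (r := 3) (σ := σ) (by decide) (by rw [hbody]; decide)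
    (fun k A => (∀ i : Fin n, 0 ≤ A 4 i 0 ∧ 0 ≤ A 5 i 0 ∧ (A 4 i 0 ≠ 0 ∨ A 5 i 0 ≠ 0)) ∧
      (mixMatrix M (fun i => A 4 i 0) fun i => A 5 i 0).det ≤ 0 ∧
      ∀ i : Fin n, i.1 < k → A 4 i 0 = 1 ∧ A 5 i 0 = 0 ∨ A 4 i 0 = 0 ∧ A 5 i 0 = 1)
    ⟨fun i => ⟨hu i, hv i, huv i⟩, hdet, by simp⟩ (by
      intro k hk τ g3 hidx harr hI
      have g0 : τ.idx 0 = n := (hidx 0 (by decide) (by rw [hbody]; decide)).trans h0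
      have g2 : τ.idx 2 = 0 := (hidx 2 (by decide) (by rw [hbody]; decide)).trans h2
      have w : ∀ a, a = 0 ∨ a = 6 ∨ a = 14 → τ.arr a = σ.arr a := by
        rintro a (rfl | rfl | rfl) <;> exact harr _ (by rw [hbody]; decide)
      rw [h0] at hk
      set κ : Fin n := ⟨k, hk⟩ with hκ
      set τ₁ := (Prog.seq (setConst (ve 4 3) 1) (setConst (ve 5 3) 0)).exec τ with hτ₁
      have a4 : ∀ i, τ₁.arr 4 i 0 = if i = k then 1 else τ.arr 4 i 0 := fun i => by
        simp [hτ₁, Prog.exec, Instr.exec, Store.write, g2, g3]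
      have a5 : ∀ i, τ₁.arr 5 i 0 = if i = k then 0 else τ.arr 5 i 0 := fun i => by
        simp [hτ₁, Prog.exec, Instr.exec, Store.write, g2, g3]
      have b : ∀ a, a = 0 ∨ a = 6 ∨ a = 14 → τ₁.arr a = σ.arr a := fun a ha => by
        rw [← w a ha]
        rcases ha with rfl | rfl | rfl <;>
          exact (Prog.seq (setConst (ve 4 3) 1) (setConst (ve 5 3) 0)).exec_arr (by decide) τ
      set u : Fin n → K := fun i => τ.arr 4 i 0 with hu
      set v : Fin n → K := fun i => τ.arr 5 i 0 with hv
      have hne : ∀ i : Fin n, (i : ℕ) = k ↔ i = κ := fun i => by rw [hκ, Fin.ext_iff]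
      have hd : (detProg.exec τ₁).arr 10 0 0 = (n.factorial : K) *
          (mixMatrix M (Function.update u κ 1) (Function.update v κ 0)).det := by
        refine exec_detProg_mixMatrix (σ := τ₁) g0 g2 (fun l hl => ?_) (fun i j => ?_) (fun i => ?_)
          (fun i => ?_) (fun i => ?_)
        · rw [b 14 (by simp), h14 l hl]
        · rw [b 0 (by simp), hM]
        · simp only [a4, hne, Function.update_apply, hu]
        · simp only [a5, hne, Function.update_apply, hv]
        · rw [b 6 (by simp), ht]
      set τ₂ := detProg.exec τ₁ with hτ₂
      have d4 : τ₂.arr 4 = τ₁.arr 4 := detProg.exec_arr (by decide) τ₁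
      have d5 : τ₂.arr 5 = τ₁.arr 5 := detProg.exec_arr (by decide) τ₁
      have e2 : τ₂.idx 2 = 0 := (detProg.exec_idx (by decide) τ₁).trans g2
      have e3 : τ₂.idx 3 = k := (detProg.exec_idx (by decide) τ₁).trans g3
      have hfac : (0 : K) < n.factorial := by exact_mod_cast n.factorial_pos
      have hout : ∃ c : K, (c = 0 ∨ c = 1) ∧
          (∀ i : Fin n, (body.exec τ).arr 4 i 0 = Function.update u κ c i) ∧
          (∀ i : Fin n, (body.exec τ).arr 5 i 0 = Function.update v κ (1 - c) i) ∧
          (mixMatrix M (Function.update u κ c) (Function.update v κ (1 - c))).det ≤ 0 := by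
        have hex : body.exec τ = (Prog.ite (.pos (sc 10))
          (.seq (setConst (ve 4 3) 0) (setConst (ve 5 3) 1)) .skip).exec τ₂ := rfl
        rw [hex]
        by_cases hp : 0 < (mixMatrix M (Function.update u κ 1) (Function.update v κ 0)).det
        · have hp' : 0 < τ₂.arr 10 0 0 := by rw [hd]; exact mul_pos hfac hp
          refine ⟨0, Or.inl rfl, fun i => ?_, fun i => ?_, ?_⟩
          · simp [Prog.exec, Test.eval, Store.read, Instr.exec, Store.write, e2, e3, hp', d4, a4, hne,
              Function.update_apply, hu]
            split_ifs <;> rfl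
          · simp [Prog.exec, Test.eval, Store.read, Instr.exec, Store.write, e2, e3, hp', d5, a5, hne,
              Function.update_apply, hv]
            split_ifs <;> rfl
          · rw [sub_zero]
            exact det_mixMatrix_zero_one_nonpos M u v κ (hI.1 κ).1 (hI.1 κ).2.1 (hI.1 κ).2.2 hI.2.1 hp
        · have hp' : ¬ 0 < τ₂.arr 10 0 0 := by
            rw [hd]
            exact not_lt.2 (mul_nonpos_of_nonneg_of_nonpos hfac.le (not_lt.1 hp))
          refine ⟨1, Or.inr rfl, fun i => ?_, fun i => ?_, ?_⟩
          · simp [Prog.exec, Test.eval, Store.read, e2, hp', d4, a4, hne,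
              Function.update_apply, hu]
          · simp [Prog.exec, Test.eval, Store.read, e2, hp', d5, a5, hne,
              Function.update_apply, hv]
          · rw [sub_self]
            exact not_lt.1 hp
      obtain ⟨c, hc, h4, h5, hdet'⟩ := hout
      simp only [h4, h5]
      refine ⟨fun i => ?_, hdet', fun i hi => ?_⟩
      · by_cases hi : i = κ
        · subst hi
          rcases hc with rfl | rfl <;> simp
        · simpa [hi] using hI.1 i
      · by_cases hi' : i = κ
        · subst hi'
          rcases hc with rfl | rfl <;> simp
        · have : (i : ℕ) < k := lt_of_le_of_ne (Nat.lt_succ_iff.1 hi) fun h => hi' ((hne i).1 h)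
          simpa [hi'] using hI.2.2 i this)
  rw [h0] at key
  obtain ⟨-, hd, hv⟩ := key
  have hex : roundProg.exec σ = (forLoop 3 body).exec σ := rfl
  rw [← hex] at hd hv
  set ρ := roundProg.exec σ
  have hmem : ∀ i : Fin n, i ∈ outputSet n ρ ↔ ρ.arr 4 i 0 ≠ 0 := fun i => by simp [outputSet]
  -- All pairs are now rounded, so both products are one and the determinant is the principal minor
  -- itself.
  rw [det_mixMatrix_indicator M (outputSet n ρ) _ _ (fun i hi => by
      rw [hmem, not_not] at hi; exact hi) (fun i hi => by
      rw [hmem] at hi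
      rcases hv i i.2 with h | h
      · exact h.2
      · exact absurd h.1 hi), Finset.prod_eq_one, Finset.prod_eq_one, one_mul, one_mul] at hd
  · exact hd
  · intro i hi
    rw [Finset.mem_compl, hmem, not_not] at hi
    rcases hv i i.2 with h | h
    · rw [hi] at h; exact absurd h.1 zero_ne_one
    · exact h.2
  · intro i hi
    rw [hmem] at hi
    rcases hv i i.2 with h | h
    · exact h.1
    · exact absurd h.1 hi

end Correctness

/-! ### Correctness of the whole program -/

section Correctness

variable {K : Type*} [Field K] [LinearOrder K] [IsStrictOrderedRing K] {n : ℕ}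

theorem exec_minorProg_singular {M : Matrix (Fin n) (Fin n) K} {α : Finset (Fin n)}
    (h : (USOCertificate.singular α).IsViolation M) :
    IsNonposMinor M (outputSet n (minorProg.exec (inputStore M (.singular α)))) := by
  set σ := inputStore M (.singular α) with hσ
  have hex : minorProg.exec σ = (forLoop 3 (setCopy (ve 4 3) (ve 1 3))).exec σ := by
    simp [minorProg, Prog.exec, Test.eval, hσ, inputStore]
  have key := exec_forLoop (p := setCopy (ve 4 3) (ve 1 3)) (r := 3) (σ := σ) (by decide) (by decide)
    (fun k A => ∀ i < k, A 4 i 0 = σ.arr 1 i 0) (by simp) (by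
      intro k hk τ g3 hidx harr hI i hi
      have g2 : τ.idx 2 = 0 := hidx 2 (by decide) (by decide)
      have a1 : τ.arr 1 = σ.arr 1 := harr 1 (by decide)
      rcases Nat.lt_succ_iff_lt_or_eq.1 hi with hi | rfl
      · simp [Prog.exec, Instr.exec, Store.write, Store.read, g2, g3, hi.ne, hI i hi]
      · simp [Prog.exec, Instr.exec, Store.write, Store.read, g2, g3, a1])
  have : outputSet n (minorProg.exec σ) = α := by
    ext i
    have := key i i.2
    rw [outputSet, Finset.mem_filter, hex, this]
    simp [hσ, inputStore, setArray, vecArray]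
  rw [this]
  exact isNonposMinor_of_singular M α h

theorem exec_minorProg_pair {M : Matrix (Fin n) (Fin n) K} {q : Fin n → K} {α β : Finset (Fin n)}
    (h : (USOCertificate.pair q α β).IsViolation M) :
    IsNonposMinor M (outputSet n (minorProg.exec (inputStore M (.pair q α β)))) := by
  obtain ⟨σ, hσ⟩ : ∃ τ, τ = inputStore M (.pair q α β) := ⟨_, rfl⟩
  obtain ⟨σ₁, hσ₁⟩ : ∃ τ, τ = countProg.exec σ := ⟨_, rfl⟩
  obtain ⟨σ₂, hσ₂⟩ : ∃ τ, τ = (cramerProg 1 16 18).exec σ₁ := ⟨_, rfl⟩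
  obtain ⟨σ₃, hσ₃⟩ : ∃ τ, τ = (cramerProg 2 17 19).exec σ₂ := ⟨_, rfl⟩
  obtain ⟨σ₄, hσ₄⟩ : ∃ τ, τ = combineProg.exec σ₃ := ⟨_, rfl⟩
  rw [← hσ]
  have hex : minorProg.exec σ = roundProg.exec σ₄ := by
    rw [hσ₄, hσ₃, hσ₂, hσ₁]
    simp [minorProg, Prog.exec, Test.eval, hσ, inputStore]
  have i1 : ∀ r, r = 0 ∨ r = 2 → σ₁.idx r = σ.idx r := fun r hr => by
    rw [hσ₁]
    rcases hr with rfl | rfl <;> exact countProg.exec_idx (by decide) σ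
  have i2 : ∀ r, r = 0 ∨ r = 2 → σ₂.idx r = σ.idx r := fun r hr => by
    rw [← i1 r hr, hσ₂]
    rcases hr with rfl | rfl <;> exact (cramerProg 1 16 18).exec_idx (by decide) σ₁
  have i3 : ∀ r, r = 0 ∨ r = 2 → σ₃.idx r = σ.idx r := fun r hr => by
    rw [← i2 r hr, hσ₃]
    rcases hr with rfl | rfl <;> exact (cramerProg 2 17 19).exec_idx (by decide) σ₂
  have i4 : ∀ r, r = 0 ∨ r = 2 → σ₄.idx r = σ.idx r := fun r hr => by
    rw [← i3 r hr, hσ₄]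
    rcases hr with rfl | rfl <;> exact combineProg.exec_idx (by decide) σ₃
  have g0 : σ.idx 0 = n := by rw [hσ]; rfl
  have g2 : σ.idx 2 = 0 := by rw [hσ]; rfl
  have a1 : ∀ a, a = 0 ∨ a = 1 ∨ a = 2 ∨ a = 3 → σ₁.arr a = σ.arr a := fun a ha => by
    rw [hσ₁]
    rcases ha with rfl | rfl | rfl | rfl <;> exact countProg.exec_arr (by decide) σ
  have a2 : ∀ a, a = 0 ∨ a = 1 ∨ a = 2 ∨ a = 3 → σ₂.arr a = σ.arr a := fun a ha => by
    rw [← a1 a ha, hσ₂]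
    rcases ha with rfl | rfl | rfl | rfl <;> exact (cramerProg 1 16 18).exec_arr (by decide) σ₁
  have a3 : ∀ a, a = 0 ∨ a = 1 ∨ a = 2 ∨ a = 3 → σ₃.arr a = σ.arr a := fun a ha => by
    rw [← a2 a ha, hσ₃]
    rcases ha with rfl | rfl | rfl | rfl <;> exact (cramerProg 2 17 19).exec_arr (by decide) σ₂
  have hM : ∀ i j : Fin n, σ.arr 0 i j = M i j := fun i j => by simp [hσ, inputStore, matArray]
  have hα : ∀ i : Fin n, σ.arr 1 i 0 = if i ∈ α then 1 else 0 := fun i => by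
    simp [hσ, inputStore, setArray, vecArray]
  have hβ : ∀ i : Fin n, σ.arr 2 i 0 = if i ∈ β then 1 else 0 := fun i => by
    simp [hσ, inputStore, setArray, vecArray]
  have hq : ∀ i : Fin n, σ.arr 3 i 0 = q i := fun i => by simp [hσ, inputStore, vecArray]
  have h14 : ∀ k < n, σ₁.arr 14 k 0 = ((k + 1 : ℕ) : K) := by
    rw [hσ₁, ← g0]; exact exec_countProg g2
  have h13 : σ₁.arr 13 0 0 = 1 := by rw [hσ₁]; exact exec_countProg_one g2
  have h14' : σ₂.arr 14 = σ₁.arr 14 := by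
    rw [hσ₂]; exact (cramerProg 1 16 18).exec_arr (by decide) σ₁
  have h13' : σ₂.arr 13 = σ₁.arr 13 := by
    rw [hσ₂]; exact (cramerProg 1 16 18).exec_arr (by decide) σ₁
  obtain ⟨c1, c2, -⟩ := exec_cramerProg (s := 1) (d := 16) (x := 18) (Or.inl rfl) (Or.inl ⟨rfl, rfl⟩)
    (σ := σ₁) (M := M) (q := q) ((i1 0 (by simp)).trans g0)
    ((i1 2 (by simp)).trans g2) h13 h14
    (fun i j => by rw [a1 0 (by simp), hM]) (fun i => by rw [a1 3 (by simp), hq])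
  obtain ⟨c3, c4, c5⟩ := exec_cramerProg (s := 2) (d := 17) (x := 19) (Or.inr rfl) (Or.inr ⟨rfl, rfl⟩)
    (σ := σ₂) (M := M) (q := q) ((i2 0 (by simp)).trans g0)
    ((i2 2 (by simp)).trans g2) (by rw [h13', h13])
    (fun k hk => by rw [h14', h14 k hk])
    (fun i j => by rw [a2 0 (by simp), hM]) (fun i => by rw [a2 3 (by simp), hq])
  have hA : (mixMatrix M (fun i => σ₁.arr 1 i 0) fun i => 1 - σ₁.arr 1 i 0) = basisMatrix α M := by
    rw [basisMatrix, a1 1 (by simp)]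
    congr 1 <;> funext i <;> rw [hα] <;> split_ifs <;> simp
  have hB : (mixMatrix M (fun i => σ₂.arr 2 i 0) fun i => 1 - σ₂.arr 2 i 0) = basisMatrix β M := by
    rw [basisMatrix, a2 2 (by simp)]
    congr 1 <;> funext i <;> rw [hβ] <;> split_ifs <;> simp
  have hu1 := h.2.1
  have hu2 := h.2.2.1
  have hfac : (n.factorial : K) ≠ 0 := by exact_mod_cast n.factorial_ne_zero
  set a := (n.factorial : K) * (basisMatrix α M).det with ha
  set b := (n.factorial : K) * (basisMatrix β M).det with hb
  have ha0 : a ≠ 0 := mul_ne_zero hfac (basisMatrix_det_ne_zero hu1)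
  have hb0 : b ≠ 0 := mul_ne_zero hfac (basisMatrix_det_ne_zero hu2)
  rw [← hσ₂, hA] at c1 c2
  rw [← hσ₃, hB] at c3 c4
  rw [← hσ₃] at c5
  have e16 : σ₃.arr 16 0 0 = a := by
    rw [hσ₃, (cramerProg 2 17 19).exec_arr (by decide) σ₂, c1]
  have e18 : ∀ i : Fin n, σ₃.arr 18 i 0 =
      a * if i ∈ α then -compCoord q α M i else compCoord q α M i := fun i => by
    rw [hσ₃, (cramerProg 2 17 19).exec_arr (by decide) σ₂, c2, cramer_basisMatrix q hu1, ← mul_assoc]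
  have e19 : ∀ i : Fin n, σ₃.arr 19 i 0 =
      b * if i ∈ β then -compCoord q β M i else compCoord q β M i := fun i => by
    rw [c4, cramer_basisMatrix q hu2, ← mul_assoc]
  have comb := exec_combineProg (σ := σ₃) ((i3 2 (by simp)).trans g2) (fun _ => rfl) (fun _ => rfl)
  rw [← hσ₄, i3 0 (by simp), g0] at comb
  simp only [e16, c3, a3 1 (Or.inr (Or.inl rfl)), a3 2 (Or.inr (Or.inr (Or.inl rfl)))] at comb
  set z : Fin n → K := fun i => a * b * ((if i ∈ α then compCoord q α M i else 0) -
      if i ∈ β then compCoord q β M i else 0) with hz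
  set w : Fin n → K := fun i => a * b * ((if i ∈ α then 0 else compCoord q α M i) -
      if i ∈ β then 0 else compCoord q β M i) with hw
  have comb' : ∀ i : Fin n, σ₄.arr 4 i 0 = |z i| ∧
      σ₄.arr 5 i 0 = if z i = 0 ∧ w i = 0 then 1 else |w i| := by
    intro i
    -- The numerators belong to `basisMatrix`, whose coordinates are negated on the set; this is why
    -- the `β` term comes first here but not in `w`.
    have hzi : a * (σ₃.arr 19 i 0) * σ.arr 2 i 0 - b * σ₃.arr 18 i 0 * σ.arr 1 i 0 = z i := by
      rw [e18, e19, hα, hβ, hz]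
      by_cases h1 : i ∈ α <;> by_cases h2 : i ∈ β <;> simp [h1, h2] <;> ring
    have hwi : (b * σ₃.arr 18 i 0 - b * σ₃.arr 18 i 0 * σ.arr 1 i 0) -
        (a * σ₃.arr 19 i 0 - a * σ₃.arr 19 i 0 * σ.arr 2 i 0) = w i := by
      rw [e18, e19, hα, hβ, hw]
      by_cases h1 : i ∈ α <;> by_cases h2 : i ∈ β <;> simp [h1, h2] <;> ring
    have := comb i i.2
    rwa [hzi, hwi] at this
  obtain ⟨s1, s2, s3⟩ := signReversal_of_pair h ha0 hb0 (z := z) (w := w) (fun _ => rfl) fun _ => rfl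
  rw [hex]
  have fr4 : ∀ c, c = 0 ∨ c = 6 ∨ c = 14 → σ₄.arr c = σ₃.arr c := by
    rw [hσ₄]
    rintro c (rfl | rfl | rfl) <;> exact combineProg.exec_arr (by decide) σ₃
  refine exec_roundProg ((i4 0 (by simp)).trans g0) ((i4 2 (by simp)).trans g2) (fun k hk => ?_) (fun i j => ?_)
    (fun i => ?_) (fun i => ?_) (fun i => ?_) (fun i => ?_) (le_of_eq ?_)
  · rw [fr4 14 (by simp), hσ₃, (cramerProg 2 17 19).exec_arr (by decide) σ₂, h14', h14 k hk]
  · rw [fr4 0 (by simp), a3 0 (by simp), hM]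
  · rw [fr4 6 (by simp), c5]
  · rw [(comb' i).1]; positivity
  · rw [(comb' i).2]; split_ifs <;> positivity
  · rw [(comb' i).1, (comb' i).2]
    by_cases h1 : z i = 0 <;> by_cases h2 : w i = 0 <;> simp [h1, h2]
  · refine det_mixMatrix_eq_zero M z w _ _ s1 s2 s3 (fun i hi => (comb' i).1) fun i hi => ?_
    rw [(comb' i).2, if_neg]
    rintro ⟨h1, h2⟩
    exact hi.elim (fun h => h h1) fun h => h h2

theorem exec_minorProg {M : Matrix (Fin n) (Fin n) K} {c : USOCertificate K n} (h : c.IsViolation M) :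
    IsNonposMinor M (outputSet n (minorProg.exec (inputStore M c))) := by
  cases c with
  | singular α => exact exec_minorProg_singular h
  | pair q α β => exact exec_minorProg_pair h

end Correctness

/-! ### Heights of the input -/

section InputHeight

variable {n : ℕ} {D L : ℕ}

/-- Numerator and cofactor `D / v.den` contribute `L` bits each; the extra bit in `2 * L + 1`
ensures `2 * D ≤ 2 ^ e`, as additions need. -/
theorem hasHeight_one (hD : D ≤ 2 ^ L) {v : ℚ} (hden : v.den ∣ D) (hnum : v.num.natAbs ≤ 2 ^ L) :
    HasHeight D (2 * L + 1) 1 v := by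
  obtain ⟨c, hc⟩ := hden
  refine ⟨v.num * c, ?_, ?_⟩
  · rw [pow_one, hc]
    push_cast
    rw [← mul_assoc, Rat.mul_den_eq_num]
  · have hcD : c ≤ 2 ^ L := le_trans (by
      rw [hc]; exact Nat.le_mul_of_pos_left c v.den_pos) hD
    rw [pow_one, abs_mul, Nat.abs_cast, ← Int.natCast_natAbs]
    have : v.num.natAbs * c ≤ 2 ^ (2 * L + 1) := calc
      v.num.natAbs * c ≤ 2 ^ L * 2 ^ L := Nat.mul_le_mul hnum hcD
      _ = 2 ^ (2 * L) := by rw [← pow_add, two_mul]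
      _ ≤ _ := Nat.pow_le_pow_right (by norm_num) (by omega)
    exact_mod_cast this

theorem two_mul_le_pow (hD : D ≤ 2 ^ L) : 2 * D ≤ 2 ^ (2 * L + 1) := calc
  2 * D ≤ 2 * 2 ^ L := Nat.mul_le_mul_left 2 hD
  _ = 2 ^ (L + 1) := by rw [pow_succ, mul_comm]
  _ ≤ _ := Nat.pow_le_pow_right (by norm_num) (by omega)

theorem hasHeight_zero_one (hD : D ≤ 2 ^ L) (p : Prop) [Decidable p] :
    HasHeight D (2 * L + 1) 1 (if p then 1 else 0) := by
  have h := two_mul_le_pow hD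
  split_ifs
  · exact_mod_cast (HasHeight.intCast (D := D) (e := 2 * L + 1) (c := 1) (by simp)).mono
      (by omega) zero_le_one
  · exact_mod_cast (HasHeight.intCast (D := D) (e := 2 * L + 1) (c := 0) (by simp)).mono
      (by omega) zero_le_one

theorem hasHeight_vecArray (hD : D ≤ 2 ^ L) {v : Fin n → ℚ}
    (hv : ∀ i, HasHeight D (2 * L + 1) 1 (v i)) (i j : ℕ) :
    HasHeight D (2 * L + 1) 1 (vecArray v i j) := by
  rw [vecArray]
  split_ifs with h
  · exact hv _
  · simpa using hasHeight_zero_one hD False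

theorem hasHeight_matArray (hD : D ≤ 2 ^ L) {M : Matrix (Fin n) (Fin n) ℚ}
    (hM : ∀ i j, HasHeight D (2 * L + 1) 1 (M i j)) (i j : ℕ) :
    HasHeight D (2 * L + 1) 1 (matArray M i j) := by
  rw [matArray]
  split_ifs with h
  · exact hM _ _
  · simpa using hasHeight_zero_one hD False

theorem prod_den_le {ι : Type*} [Fintype ι] (f : ι → ℚ) :
    ∏ i, (f i).den ≤ 2 ^ ∑ i, bitSize (f i) := by
  rw [← Finset.prod_pow_eq_pow_sum]
  refine Finset.prod_le_prod' fun i _ => ?_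
  exact (Nat.lt_size_self _).le.trans (Nat.pow_le_pow_right (by norm_num) (by rw [bitSize]; omega))

theorem natAbs_num_le {ι : Type*} [Fintype ι] (f : ι → ℚ) (i : ι) :
    (f i).num.natAbs ≤ 2 ^ ∑ i, bitSize (f i) := by
  refine (Nat.lt_size_self _).le.trans (Nat.pow_le_pow_right (by norm_num) ?_)
  refine le_trans ?_ (Finset.single_le_sum (f := fun i => bitSize (f i)) (fun _ _ => Nat.zero_le _)
    (Finset.mem_univ i))
  rw [bitSize]; omega

/-- Converts step bounds in `n` into bounds in the input length. -/
theorem card_le_inputBits (M : Matrix (Fin n) (Fin n) ℚ) (c : USOCertificate ℚ n) :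
    n ≤ inputBits M c := by
  cases c <;> simp only [inputBits] <;> omega

/-- The entries of the input have a common denominator of polynomial bit length. -/
theorem exists_hasHeights_inputStore (M : Matrix (Fin n) (Fin n) ℚ) (c : USOCertificate ℚ n) :
    ∃ D, 0 < D ∧ D ≤ 2 ^ inputBits M c ∧
      (inputStore M c).HasHeights D (2 * inputBits M c + 1) fun _ => 1 := by
  have hsum : ∑ i, ∑ j, bitSize (M i j) = ∑ p : Fin n × Fin n, bitSize (M p.1 p.2) :=
    (Fintype.sum_prod_type fun p : Fin n × Fin n => bitSize (M p.1 p.2)).symm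
  have hden : ∀ {ι : Type} [Fintype ι] (f : ι → ℚ) (i : ι), (f i).den ∣ ∏ i, (f i).den :=
    fun f i => Finset.dvd_prod_of_mem (fun i => (f i).den) (Finset.mem_univ i)
  have hpos : ∀ {ι : Type} [Fintype ι] (f : ι → ℚ), 0 < ∏ i, (f i).den :=
    fun f => Finset.prod_pos fun i _ => (f i).den_pos
  have hM1 := prod_den_le fun p : Fin n × Fin n => M p.1 p.2
  have hM2 := fun i j => natAbs_num_le (fun p : Fin n × Fin n => M p.1 p.2) (i, j)
  rw [← hsum] at hM1
  simp only [← hsum] at hM2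
  cases c with
  | singular α =>
    have hL : ∑ i, ∑ j, bitSize (M i j) ≤ inputBits M (.singular α) := by simp [inputBits]
    have hpow := Nat.pow_le_pow_right (n := 2) (by norm_num) hL
    have hD := hM1.trans hpow
    -- The product of all denominators serves as common denominator; its bit length is at most the
    -- sum of theirs.
    refine ⟨∏ p : Fin n × Fin n, (M p.1 p.2).den, hpos _, hD, fun a i j => ?_⟩
    simp only [inputStore]
    split_ifs
    · exact hasHeight_matArray hD (fun i j => hasHeight_one hD
        (hden (fun p : Fin n × Fin n => M p.1 p.2) (i, j)) ((hM2 i j).trans hpow)) i j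
    · exact hasHeight_vecArray hD (fun i => hasHeight_zero_one hD _) i j
    · simpa using hasHeight_zero_one hD False
  | pair q α β =>
    have hL : ∑ i, ∑ j, bitSize (M i j) + ∑ i, bitSize (q i) ≤ inputBits M (.pair q α β) := by
      simp [inputBits]
    have hpow := Nat.pow_le_pow_right (n := 2) (by norm_num) hL
    have hD : (∏ p : Fin n × Fin n, (M p.1 p.2).den) * ∏ i, (q i).den ≤
        2 ^ inputBits M (.pair q α β) := by
      refine le_trans ?_ hpow
      rw [pow_add]
      exact Nat.mul_le_mul hM1 (prod_den_le q)
    refine ⟨_, Nat.mul_pos (hpos _) (hpos _), hD, fun a i j => ?_⟩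
    simp only [inputStore]
    split_ifs
    · refine hasHeight_matArray hD (fun i j => hasHeight_one hD
        ((hden (fun p : Fin n × Fin n => M p.1 p.2) (i, j)).mul_right _)
        ((hM2 i j).trans (Nat.pow_le_pow_right (by norm_num) (by omega)))) i j
    · exact hasHeight_vecArray hD (fun i => hasHeight_zero_one hD _) i j
    · exact hasHeight_vecArray hD (fun i => hasHeight_zero_one hD _) i j
    · exact hasHeight_vecArray hD (fun i => hasHeight_one hD ((hden q i).mul_left _)
        ((natAbs_num_le q i).trans (Nat.pow_le_pow_right (by norm_num) (by omega)))) i j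
    · simpa using hasHeight_zero_one hD False

end InputHeight

/-! ### Heights during the phases of the program -/

section Heights

/-- Height bounds during the phases that compute determinants, for inputs of height `h`. -/
def detHeight (h a : ℕ) : ℕ :=
  if a = 7 then 2 * h + 3 else if a = 22 then 2 * h + 2 else if a = 20 ∨ a = 21 then 2 * h + 1
  else if a = 4 ∨ a = 5 ∨ a = 6 ∨ a = 23 then h + 1 else h

/-- The growth per step of the height bounds `detHeight`. -/
def detGrowth (h a : ℕ) : ℕ :=
  if a < 8 ∨ a = 13 ∨ a = 14 ∨ a = 20 ∨ a = 21 ∨ a = 22 ∨ a = 23 then 0 else 2 * h + 3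

/-- Height bounds during the phase that combines the two solutions, for inputs of height `h`. -/
def combineHeight (h a : ℕ) : ℕ :=
  if a = 26 ∨ a = 27 then 2 * h else if a = 28 ∨ a = 29 then 3 * h
  else if a = 4 ∨ a = 5 ∨ 29 < a ∧ a < 34 then 3 * h + if a = 5 then 3 else if a = 4 ∨ a = 33 then 2 else 1
  else h

theorem countProg_typed : countProg.Typed (fun _ => 1) fun _ => 1 := by
  simp [countProg, forLoop, Prog.Typed, Instr.Typed]

/-- The matrix in array `7` is rebuilt from arrays of growth zero and has height `2 * h + 3`. One
product with it raises the height of the recursion by that amount, which dictates the growth rate.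
-/
theorem detProg_typed (h : ℕ) : detProg.Typed (detHeight h) (detGrowth h) := by
  simp [detProg, buildProg, identityProg, mulProg, mulEntryProg, traceProg, updateProg, forLoop,
    Prog.Typed, Instr.Typed, detHeight, detGrowth]
  omega

theorem cramerProg_typed (h : ℕ) : (cramerProg 1 16 18).Typed (detHeight h) (detGrowth h) ∧
    (cramerProg 2 17 19).Typed (detHeight h) (detGrowth h) := by
  simp [cramerProg, selectProg, replaceProg, restoreProg, forLoop, Prog.Typed, detProg_typed,
    Instr.Typed, detHeight, detGrowth]

/-- The determinants are only tested for sign and the coefficients are overwritten by constants, so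
heights do not compound over the rounds. -/
theorem roundProg_typed (h : ℕ) : roundProg.Typed (detHeight h) (detGrowth h) := by
  simp [roundProg, forLoop, Prog.Typed, detProg_typed, Instr.Typed]

theorem combineProg_typed (h : ℕ) : combineProg.Typed (combineHeight h) fun _ => 0 := by
  simp [combineProg, combineEntryProg, nonzeroProg, residualProg, absProg, forLoop, Prog.Typed, Instr.Typed, combineHeight]
  omega

theorem detHeight_bounds (h a : ℕ) : h ≤ detHeight h a ∧ detHeight h a ≤ 2 * h + 3 := by
  unfold detHeight; split_ifs <;> omega

theorem detGrowth_le (h a : ℕ) : detGrowth h a ≤ 2 * h + 3 := by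
  unfold detGrowth; split_ifs <;> omega

theorem combineHeight_bounds (h a : ℕ) : h ≤ combineHeight h a ∧ combineHeight h a ≤ 3 * h + 3 := by
  unfold combineHeight; split_ifs <;> omega

variable {D e : ℕ}

/-- Uniform height bounds before and after a well-typed program. -/
theorem Prog.Typed.uniform (hD0 : 0 < D) (hD : 2 * D ≤ 2 ^ e) {H G : ℕ → ℕ} {p : Prog}
    (hp : p.Typed H G) {h T B : ℕ} {σ : Store ℚ} (hσ : σ.HasHeights D e fun _ => h)
    (hH : ∀ a, h ≤ H a) (hT : p.cost unitSize σ ≤ T) (hB : ∀ a, H a + T * G a ≤ B) :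
    (p.exec σ).HasHeights D e (fun _ => B) ∧
      p.cost bitSize σ ≤ p.cost unitSize σ * (10 + 6 * (e * B)) := by
  have hD' : D ≤ 2 ^ e := by omega
  have h0 : σ.HasHeights D e fun a => H a + 0 * G a :=
    hσ.mono hD' fun a => (hH a).trans (Nat.le_add_right _ _)
  obtain ⟨h1, h2⟩ := Prog.cost_bitSize_le hD0 hD hp h0
  have hB' : ∀ a, H a + (0 + p.cost unitSize σ) * G a ≤ B := fun a => by
    refine le_trans (Nat.add_le_add_left (Nat.mul_le_mul_right _ ?_) _) (hB a)
    omega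
  exact ⟨h1.mono hD' hB', h2 B hB'⟩

/-- The height of the entries after a phase that computes determinants and takes `T` steps. -/
def detBound (T h : ℕ) : ℕ := (T + 1) * (2 * h + 3)

theorem det_bound (T h a : ℕ) : detHeight h a + T * detGrowth h a ≤ detBound T h := by
  have h1 := (detHeight_bounds h a).2
  have h2 := Nat.mul_le_mul_left T (detGrowth_le h a)
  rw [detBound, add_mul, one_mul]
  omega

theorem le_detBound (T h : ℕ) : h ≤ detBound T h := by
  rw [detBound, add_mul, one_mul]
  omega

theorem minorProg_cost_bitSize_le (hD0 : 0 < D) (hD : 2 * D ≤ 2 ^ e) {σ : Store ℚ}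
    (hσ : σ.HasHeights D e fun _ => 1) {T : ℕ} (hT : minorProg.cost unitSize σ ≤ T) :
    minorProg.cost bitSize σ ≤
      T * (10 + 6 * (e * detBound T (3 * detBound T (1 + T) + 3))) := by
  have hD' : D ≤ 2 ^ e := by omega
  set B := detBound T (3 * detBound T (1 + T) + 3) with hB
  refine le_trans ?_ (Nat.mul_le_mul_right _ hT)
  have hB3 : 3 * detBound T (1 + T) + 3 ≤ B := le_detBound _ _
  have hB1 : 1 + T ≤ detBound T (1 + T) := le_detBound _ _
  have hmono : ∀ {x y s : ℕ}, x ≤ y → s * (10 + 6 * (e * x)) ≤ s * (10 + 6 * (e * y)) := by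
    intro x y s h
    gcongr
  by_cases hb : (Test.idxLt 2 1).eval σ = true
  · simp only [minorProg, Prog.cost, hb, if_true, Test.cost] at hT ⊢
    obtain ⟨h1, k1⟩ := countProg_typed.uniform hD0 hD (T := T) (B := 1 + T) hσ (fun _ => le_rfl)
      (by omega) (fun _ => by omega)
    -- Both uses of Cramer's rule share one typing, as the second does not read the results of the
    -- first. The total step bound `T` serves for every phase.
    have hty : (Prog.seq (cramerProg 1 16 18) (cramerProg 2 17 19)).Typed (detHeight (1 + T))
      (detGrowth (1 + T)) := cramerProg_typed (1 + T)
    obtain ⟨h3, k3⟩ := hty.uniform hD0 hD (T := T) h1 (fun a => (detHeight_bounds _ a).1)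
      (by simp only [Prog.cost]; omega) (fun a => det_bound T (1 + T) a)
    simp only [Prog.exec, Prog.cost] at h3 k3
    obtain ⟨h4, k4⟩ := (combineProg_typed (detBound T (1 + T))).uniform hD0 hD (T := T) h3
      (fun a => (combineHeight_bounds _ a).1) (by omega)
      (fun a => by rw [mul_zero, add_zero]; exact (combineHeight_bounds _ a).2)
    obtain ⟨-, k5⟩ := (roundProg_typed (3 * detBound T (1 + T) + 3)).uniform hD0 hD (T := T) h4
      (fun a => (detHeight_bounds _ a).1) (by omega) (fun a => det_bound T _ a)
    rw [← hB] at k5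
    have k1' := k1.trans (hmono (y := B) (by omega))
    have k3' := k3.trans (hmono (y := B) (by omega))
    have k4' := k4.trans (hmono (y := B) (by omega))
    simp only [add_mul, one_mul] at k1' k3' k4' k5 ⊢
    omega
  · simp only [minorProg, Prog.cost, hb, Test.cost] at hT ⊢
    have hty : (forLoop 3 (setCopy (ve 4 3) (ve 1 3))).Typed (fun _ => 1) fun _ => 1 := by
      simp [forLoop, Prog.Typed, Instr.Typed]
    obtain ⟨-, k1⟩ := hty.uniform hD0 hD (T := T) (B := 1 + T) hσ (fun _ => le_rfl)
      (le_trans (Nat.le_add_left _ _) hT) (fun _ => by omega)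
    have k1' := k1.trans (hmono (y := B) (by omega))
    simp only [add_mul, one_mul, Bool.false_eq_true, if_false] at k1' ⊢
    omega

end Heights

/-! ### The final polynomial bounds -/

section Main

theorem minorProg_loopsOverZero : minorProg.LoopsOverZero := by
  simp [minorProg, countProg, cramerProg, selectProg, replaceProg, restoreProg, combineProg,
    combineEntryProg, nonzeroProg, residualProg, absProg, roundProg, detProg, buildProg, identityProg, mulProg, mulEntryProg,
    traceProg, updateProg, forLoop, Prog.LoopsOverZero]

theorem zero_notMem_idxWrites_minorProg : 0 ∉ minorProg.idxWrites := by decide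

theorem inputStore_idx_zero {K : Type*} [Field K] [LinearOrder K] {n : ℕ}
    (M : Matrix (Fin n) (Fin n) K) (c : USOCertificate K n) : (inputStore M c).idx 0 = n := by
  cases c <;> rfl

theorem minorProg_cost_unitSize_le {K : Type*} [Field K] [LinearOrder K] {n : ℕ}
    (M : Matrix (Fin n) (Fin n) K) (c : USOCertificate K n) :
    minorProg.cost unitSize (inputStore M c) ≤ minorProg.stepPoly.eval n := by
  have := minorProg.cost_unitSize_le minorProg_loopsOverZero zero_notMem_idxWrites_minorProg
    (inputStore M c)
  rwa [inputStore_idx_zero] at this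

theorem monotone_eval_nat (P : Polynomial ℕ) : Monotone fun k : ℕ => P.eval k := by
  intro k l h
  simp only [Polynomial.eval_eq_sum_range]
  gcongr

open Polynomial in
/-- The polynomial bounding the bit complexity of `minorProg`. -/
noncomputable def bitPoly (T : Polynomial ℕ) : Polynomial ℕ :=
  T * (10 + 6 * ((2 * X + 1) * ((T + 1) * (2 * (3 * ((T + 1) * (2 * (1 + T) + 3)) + 3) + 3))))

theorem eval_bitPoly (T : Polynomial ℕ) (L : ℕ) : (bitPoly T).eval L =
    T.eval L * (10 + 6 * ((2 * L + 1) *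
      detBound (T.eval L) (3 * detBound (T.eval L) (1 + T.eval L) + 3))) := by
  simp [bitPoly, detBound]

end Main

end PMatrixUSO

theorem mainTheorem5 :
    ∃ (p : PMatrixUSO.Prog) (P Q : Polynomial ℕ),
      (∀ (n : ℕ) (M : Matrix (Fin n) (Fin n) ℝ) (c : PMatrixUSO.USOCertificate ℝ n),
        c.IsViolation M →
          PMatrixUSO.IsNonposMinor M
            (PMatrixUSO.outputSet n (p.exec (PMatrixUSO.inputStore M c))) ∧
          p.cost PMatrixUSO.unitSize (PMatrixUSO.inputStore M c) ≤ P.eval n) ∧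
      (∀ (n : ℕ) (M : Matrix (Fin n) (Fin n) ℚ) (c : PMatrixUSO.USOCertificate ℚ n),
        c.IsViolation M →
          PMatrixUSO.IsNonposMinor M
            (PMatrixUSO.outputSet n (p.exec (PMatrixUSO.inputStore M c))) ∧
          p.cost PMatrixUSO.bitSize (PMatrixUSO.inputStore M c) ≤
            Q.eval (PMatrixUSO.inputBits M c)) := by
  refine ⟨PMatrixUSO.minorProg, PMatrixUSO.minorProg.stepPoly,
    PMatrixUSO.bitPoly PMatrixUSO.minorProg.stepPoly, fun n M c hc => ?_, fun n M c hc => ?_⟩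
  · exact ⟨PMatrixUSO.exec_minorProg hc, PMatrixUSO.minorProg_cost_unitSize_le M c⟩
  · refine ⟨PMatrixUSO.exec_minorProg hc, ?_⟩
    obtain ⟨D, hD0, hD, hσ⟩ := PMatrixUSO.exists_hasHeights_inputStore M c
    rw [PMatrixUSO.eval_bitPoly]
    exact PMatrixUSO.minorProg_cost_bitSize_le hD0 (PMatrixUSO.two_mul_le_pow hD) hσ
      ((PMatrixUSO.minorProg_cost_unitSize_le M c).trans
        (PMatrixUSO.monotone_eval_nat _ (PMatrixUSO.card_le_inputBits M c)))
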